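/- A ribbon graph $G=(V(G),E(G))$ is a (possibly non-orientable) surface with boundary, presented as the union of finitely many discs, the vertices and the edges, such that vertices and edges meet in disjoint line segments, each such segment lies on the boundary of exactly one vertex and exactly one edge, and every edge contains exactly two of them. For a connected ribbon graph $G$ let $\gamma(G)$ be its Euler genus: if $\Sigma$ is the closed surface obtained by capping off the boundary components of $G$ with discs, then $\gamma(G)=2-\chi(\Sigma)$, i.e. twice the genus of $\Sigma$ if $\Sigma$ is orientable and the genus of $\Sigma$ if it is not. $G$ is *plane* if it is connected and $\gamma(G)=0$, and is *$\mathbb{R}\mathrm{P}^2$* if it is connected and $\gamma(G)=1$. For $A\subseteq E(G)$ the *partial dual* $G^A$ is the ribbon graph whose vertices are discs bounded by the boundary components of the spanning ribbon subgraph $(V(G),A)$, and whose edges are the edges of $G$, attached along the arcs in which they meet these boundary components (each edge in $A$ along its two free sides, each edge not in $A$ along its two original ends). A connected ribbon graph $K$ is a *join* of ribbon subgraphs $P$ and $Q$, written $K=P\vee Q$, if $P$ and $Q$ are connected and each has at least one edge, $K=P\cup Q$, $P\cap Q$ is a single vertex $v$, and there is an arc on the boundary of $v$ such that all edges of $P$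 incident to $v$ meet $v$ on this arc and no edge of $Q$ meets this arc. Write $H_1\vee\cdots\vee H_l:=(\cdots(H_1\vee H_2)\vee\cdots)\vee H_l$. A set $A\subseteq E(G)$ *defines a plane-join-biseparation* of $G$ if $G=H_1\vee\cdots\vee H_l$ for some $l\ge 1$ and some plane ribbon subgraphs $H_1,\dots,H_l$ of $G$ with $A=\bigcup_{i\in I}E(H_i)$ for some $I\subseteq\{1,\dots,l\}$. It *defines an $\mathbb{R}\mathrm{P}^2$-join-biseparation* of $G$ if $G=H_1\vee\cdots\vee H_l$ for some $l\ge 1$ and some ribbon subgraphs $H_1,\dots,H_l$ of $G$, exactly one of which is $\mathbb{R}\mathrm{P}^2$ and all the others of which are plane, with $A=\bigcup_{i\in I}E(H_i)$ for some $I\subseteq\{1,\dots,l\}$. **Theorem.** Let $G$ be a connected ribbon graph and $A\subseteq E(G)$. Then 1. $G$ and $G^A$ are both plane if and only if $A$ defines a plane-join-biseparation of $G$; 2. $G$ and $G^A$ are both $\mathbb{R}\mathrm{P}^2$ if and only if $A$ defines an $\mathbb{R}\mathrm{P}^2$-join-biseparation of $G$. -/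

import Mathlib

universe u

/-- The orbit equivalence relation on `X` generated by two self-maps `σ` and `τ`. -/
def orbitSetoid {X : Type u} (σ τ : X → X) : Setoid X :=
  Relation.EqvGen.setoid (fun x y => y = σ x ∨ y = τ x)

/-- A (finite, not necessarily orientable, not necessarily connected) ribbon graph, given by its
flags.

Each edge disc is glued to the vertex discs along two disjoint arcs, hence its boundary circle is
cut into two *ends* (the glued arcs) and two *sides* (the free arcs), which meet in four points:
these are the flags of the edge.  Every flag also lies on the boundary circle of one vertex disc.

* `τ₀` sends a flag to the other flag on the same side of its edge;
* `τ₂` sends a flag to the other flag on the same end of its edge;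
* `τ₁` sends a flag to the neighbouring flag along the free arc of the boundary of its vertex
  which starts at the flag.

The vertices that carry flags are the orbits of `τ₁, τ₂`; a vertex that carries no flag is an
isolated vertex, i.e. a disc that meets no edge. The edges are the orbits of `τ₀, τ₂`. -/
structure RibbonGraph where
  /-- the set of vertices -/
  V : Type u
  /-- the set of edges -/
  E : Type u
  /-- the set of flags -/
  Flag : Type u
  finite_V : Finite V
  finite_E : Finite E
  finite_Flag : Finite Flag
  τ₀ : Flag → Flag
  τ₁ : Flag → Flag
  τ₂ : Flag → Flag
  invol₀ : ∀ x, τ₀ (τ₀ x) = x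
  invol₁ : ∀ x, τ₁ (τ₁ x) = x
  invol₂ : ∀ x, τ₂ (τ₂ x) = x
  comm : ∀ x, τ₀ (τ₂ x) = τ₂ (τ₀ x)
  ne₀ : ∀ x, τ₀ x ≠ x
  ne₁ : ∀ x, τ₁ x ≠ x
  ne₂ : ∀ x, τ₂ x ≠ x
  ne₀₂ : ∀ x, τ₀ (τ₂ x) ≠ x
  /-- the vertex on whose boundary a flag lies -/
  vert : Flag → V
  /-- the edge on whose boundary a flag lies -/
  edge : Flag → E
  vert_eq_iff : ∀ x y, vert x = vert y ↔ (orbitSetoid τ₁ τ₂) x y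
  edge_eq_iff : ∀ x y, edge x = edge y ↔ y = x ∨ y = τ₀ x ∨ y = τ₂ x ∨ y = τ₀ (τ₂ x)
  edge_surjective : Function.Surjective edge

namespace RibbonGraph

variable (G : RibbonGraph.{u})

theorem edge_τ₀ (x : G.Flag) : G.edge (G.τ₀ x) = G.edge x :=
  ((G.edge_eq_iff x (G.τ₀ x)).2 (Or.inr (Or.inl rfl))).symm

theorem edge_τ₂ (x : G.Flag) : G.edge (G.τ₂ x) = G.edge x :=
  ((G.edge_eq_iff x (G.τ₂ x)).2 (Or.inr (Or.inr (Or.inl rfl)))).symm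

/-! ### Partial duals -/

open Classical in
/-- Follow the boundary of the spanning ribbon subgraph `(V(G), A)` from a flag, away from the
free arc of the vertex boundary at this flag: along the side of the edge if the edge is in `A`,
along the end of the edge (which then is an arc on the boundary of the vertex) if it is not. -/
noncomputable def along (A : Set G.E) (x : G.Flag) : G.Flag :=
  if G.edge x ∈ A then G.τ₀ x else G.τ₂ x

open Classical in
/-- The opposite choice: along the end of the edge if the edge is in `A`, along its side if
it is not. -/
noncomputable def coAlong (A : Set G.E) (x : G.Flag) : G.Flag :=
  if G.edge x ∈ A then G.τ₂ x else G.τ₀ x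

/-- The partial dual `G^A`. Its vertices are discs bounded by the boundary components of the
spanning ribbon subgraph `(V(G), A)`: those that carry flags are the orbits of `τ₁` and `along A`,
the others are the boundaries of the isolated vertices of `G`. The edges of `G` are glued to them
along the arcs in which they meet these boundary components, that is, along their sides for the
edges in `A` and along their ends for the edges not in `A`. The edge set stays the same. -/
noncomputable def partialDual (A : Set G.E) : RibbonGraph.{u} where
  V := Quotient (orbitSetoid G.τ₁ (G.along A)) ⊕ {v : G.V // v ∉ Set.range G.vert}
  E := G.E
  Flag := G.Flag
  finite_V := by
    have := G.finite_V
    have := G.finite_Flag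
    infer_instance
  finite_E := G.finite_E
  finite_Flag := G.finite_Flag
  τ₀ := G.coAlong A
  τ₁ := G.τ₁
  τ₂ := G.along A
  invol₀ x := by
    by_cases h : G.edge x ∈ A <;> simp [coAlong, h, edge_τ₀, edge_τ₂, G.invol₀, G.invol₂]
  invol₁ := G.invol₁
  invol₂ x := by
    by_cases h : G.edge x ∈ A <;> simp [along, h, edge_τ₀, edge_τ₂, G.invol₀, G.invol₂]
  comm x := by
    by_cases h : G.edge x ∈ A <;> simp [along, coAlong, h, edge_τ₀, edge_τ₂, G.comm]
  ne₀ x := by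
    by_cases h : G.edge x ∈ A <;> simp [coAlong, h, G.ne₀, G.ne₂]
  ne₁ := G.ne₁
  ne₂ x := by
    by_cases h : G.edge x ∈ A <;> simp [along, h, G.ne₀, G.ne₂]
  ne₀₂ x := by
    have := G.ne₀₂ x
    by_cases h : G.edge x ∈ A <;> simp [along, coAlong, h, edge_τ₀, edge_τ₂, ← G.comm, this]
  vert x := Sum.inl (Quotient.mk _ x)
  edge := G.edge
  vert_eq_iff x y := by
    rw [Sum.inl.injEq]
    exact Quotient.eq
  edge_eq_iff x y := by
    rw [G.edge_eq_iff]
    by_cases h : G.edge x ∈ A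
    · simp only [along, coAlong, h, edge_τ₀, if_true, ← G.comm]
      tauto
    · simp only [along, coAlong, h, edge_τ₂, if_false]
  edge_surjective := G.edge_surjective

/-! ### Ribbon subgraphs, connectedness and genus -/

/-- A ribbon subgraph of `G`: a set of vertices and a set of edges both of whose ends lie on
vertices of the set. -/
@[ext]
structure Subgraph where
  verts : Set G.V
  edges : Set G.E
  vert_mem : ∀ x, G.edge x ∈ edges → G.vert x ∈ verts

/-- `G` as a ribbon subgraph of itself. -/
def whole : G.Subgraph where
  verts := Set.univ
  edges := Set.univ
  vert_mem _ _ := Set.mem_univ _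

namespace Subgraph

variable {G}
variable (H : G.Subgraph)

/-- Two vertices are adjacent in `H` if an edge of `H` joins them. -/
def Adj (v w : G.V) : Prop :=
  ∃ x, G.edge x ∈ H.edges ∧ G.vert x = v ∧ G.vert (G.τ₀ x) = w

/-- `H` is nonempty and connected. -/
def Connected : Prop :=
  H.verts.Nonempty ∧ ∀ v ∈ H.verts, ∀ w ∈ H.verts, Relation.ReflTransGen H.Adj v w

/-- The number of boundary components of the surface `H`. The boundary of `H` runs along the free
arcs of the boundaries of its vertices, the sides of the edges in `H`, and the arcs left free by
the edges of `G` that are not in `H`; moreover there is one boundary component for each vertex of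
`H` that is isolated in `G`. -/
noncomputable def numBoundary : ℕ :=
  ((Quotient.mk (orbitSetoid G.τ₁ (G.along H.edges))) '' {x | G.vert x ∈ H.verts}).ncard
    + {v ∈ H.verts | v ∉ Set.range G.vert}.ncard

/-- The Euler characteristic of the closed surface obtained from `H` by capping off all boundary
components with discs. -/
noncomputable def eulerChar : ℤ :=
  (H.verts.ncard : ℤ) - H.edges.ncard + H.numBoundary

/-- The Euler genus of a connected ribbon subgraph: if `g` is the genus of the capped-off surface,
it is `2g` if the surface is orientable (Euler characteristic `2 - 2g`) and `g` if it is not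
(Euler characteristic `2 - g`). Meaningful for connected `H` only. -/
noncomputable def eulerGenus : ℤ := 2 - H.eulerChar

/-- `H` is a plane ribbon graph. -/
def IsPlane : Prop := H.Connected ∧ H.eulerGenus = 0

/-- `H` is an `ℝP²` ribbon graph. -/
def IsRP2 : Prop := H.Connected ∧ H.eulerGenus = 1

/-! ### One-sums and joins -/

/-- `K = P ⊕ Q`, a 1-sum occurring at the vertex `v`: `P` and `Q` are connected, non-trivial
(not just an isolated vertex), their union is `K`, and they meet exactly in the vertex `v`. -/
structure IsOneSumAt (K P Q : G.Subgraph) (v : G.V) : Prop where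
  connected_left : P.Connected
  connected_right : Q.Connected
  nontrivial_left : P.edges.Nonempty
  nontrivial_right : Q.edges.Nonempty
  verts_union : K.verts = P.verts ∪ Q.verts
  edges_union : K.edges = P.edges ∪ Q.edges
  verts_inter : P.verts ∩ Q.verts = {v}
  edges_inter : P.edges ∩ Q.edges = ∅

/-- `K = P ∨ Q`: a 1-sum at some vertex `v` such that there is an arc on the boundary of `v` which
contains all ends at `v` of edges of `P` and meets no end of an edge of `Q`. The map `τ₁ ∘ τ₂`
goes from one edge end to the next one around the boundary circle of the vertex; the arc covers
the `n` consecutive ends (of edges of `G`) that begin with the one at the flag `x`. -/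
def IsJoin (K P Q : G.Subgraph) : Prop :=
  ∃ v, IsOneSumAt K P Q v ∧
    ∃ (x : G.Flag) (n : ℕ), G.vert x = v ∧
      (∀ y, G.vert y = v → G.edge y ∈ P.edges →
        ∃ i < n, y = (G.τ₁ ∘ G.τ₂)^[i] x ∨ y = G.τ₂ ((G.τ₁ ∘ G.τ₂)^[i] x)) ∧
      ∀ i < n, G.edge ((G.τ₁ ∘ G.τ₂)^[i] x) ∉ Q.edges

/-- `K = H 0 ∨ H 1 ∨ ⋯ ∨ H l`, bracketed from the left: there are partial joins
`L 0 = H 0`, `L (i+1) = L i ∨ H (i+1)`, with `L l = K`. -/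
def IsJoinSequence (K : G.Subgraph) {l : ℕ} (H : Fin (l + 1) → G.Subgraph) : Prop :=
  ∃ L : Fin (l + 1) → G.Subgraph, L 0 = H 0 ∧
    (∀ i : Fin l, IsJoin (L i.succ) (L i.castSucc) (H i.succ)) ∧ L (Fin.last l) = K

end Subgraph

/-- A connected ribbon graph. -/
def Connected : Prop := G.whole.Connected

/-- A plane ribbon graph. -/
def IsPlane : Prop := G.whole.IsPlane

/-- An `ℝP²` ribbon graph. -/
def IsRP2 : Prop := G.whole.IsRP2

/-- `A` defines a plane-join-biseparation of `G`: `G` is a join of one or more plane ribbon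
subgraphs, and `A` is the union of the edge sets of some of them. -/
def IsPlaneJoinBiseparation (A : Set G.E) : Prop :=
  ∃ (l : ℕ) (H : Fin (l + 1) → G.Subgraph), G.whole.IsJoinSequence H ∧
    (∃ I : Set (Fin (l + 1)), A = ⋃ i ∈ I, (H i).edges) ∧
    ∀ i, (H i).IsPlane

/-- `A` defines an `ℝP²`-join-biseparation of `G`: `G` is a join of one or more ribbon
subgraphs, exactly one of which is `ℝP²` and all the others of which are plane, and `A` is the
union of the edge sets of some of them. -/
def IsRP2JoinBiseparation (A : Set G.E) : Prop :=
  ∃ (l : ℕ) (H : Fin (l + 1) → G.Subgraph), G.whole.IsJoinSequence H ∧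
    (∃ I : Set (Fin (l + 1)), A = ⋃ i ∈ I, (H i).edges) ∧
    ∃ j, (H j).IsRP2 ∧ ∀ i, i ≠ j → (H i).IsPlane

end RibbonGraph

/-! Let k(S) and f(S) be the numbers of components and of boundary components of the spanning ribbon
subgraph (V(G), S); f(∅) is the number of vertices. If G is connected with edge set E, the Euler
genus of G is 2 + |E| - f(∅) - f(E), and that of the partial dual is 2 + |E| - f(A) - f(E \ A). Both
are nonnegative (`genus_bound`, `genus_bound_partialDual`).

A join is the same thing as a cut: a set of flags that is separated from its complement by exactly
two corners (`IsJoin.exists_isCut`, `isJoin_of_isCut`). Regluing at these corners shows that f is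
additive over the two sides, so both genera add up over a join (`IsJoin.eulerGenus`,
`IsJoin.dualGenus`). For a part contained in A or disjoint from A the two genera agree, since the
two boundary counts are at most interchanged. This proves that biseparations give the stated genera.
Conversely, if G is a join of such parts, then nonnegative integers with sum 0 or 1 must be all
zero, or all zero but for a single one. What remains is to decompose G into such monochromatic parts
when both genera are at most 1.

The core is `exists_isCut`, which finds a cut when A is a nonempty proper subset of the edges.
Colour the ends of edges by membership in A and call a corner mixed if the colour changes there. The
radial ribbon graph has the vertices and the boundary components as its vertices and the corners as
its edges; its Euler genus is bounded by that of G. Two families of closed walks are compared: the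
boundary walks of the mixed corners in the radial graph, and walks that account for the boundary
components of A and of E \ A. An Euler characteristic count shows that some walk in one of the
families passes fewer than four mixed flags on the vertex level, hence by parity exactly two. These
give two corners that a closed curve can cross while passing through one vertex and one boundary
component only. Surgery along the curve raises both f(∅) and f(E) by one. If it kept the number of
components, the Euler genus would fall by two, which is impossible from a value at most 1; so the
curve separates.

For the induction all this is carried out for an edge set S inside G. The ends of edges outside S
are still present, but their colour is arbitrary. If one side of the separation has no edge of S, it
can be recoloured to remove mixed corners, and the search continues. Finally, minimal cuts peel off
monochromatic parts one at a time (`Connected.exists_isJoin`). -/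

/-! ### Counting the classes of a setoid -/

namespace Setoid

/-- The number of classes of a setoid. -/
noncomputable def numClasses {X : Type u} (s : Setoid X) : ℕ := Nat.card (Quotient s)

variable {X Y : Type u} [Finite X]

theorem numClasses_le_of_map {s : Setoid X} {t : Setoid Y} (φ : X → Y)
    (h : ∀ a b, s a b → t (φ a) (φ b)) (hs : ∀ y, ∃ x, t (φ x) y) :
    t.numClasses ≤ s.numClasses := by
  refine Nat.card_le_card_of_surjective
    (Quotient.map φ h : Quotient s → Quotient t) ?_
  intro q
  induction q using Quotient.inductionOn with
  | h y =>
    obtain ⟨x, hx⟩ := hs y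
    exact ⟨Quotient.mk _ x, Quotient.sound hx⟩

theorem numClasses_anti {s t : Setoid X} (h : s ≤ t) : t.numClasses ≤ s.numClasses :=
  numClasses_le_of_map id (fun _ _ hab => h hab) fun y => ⟨y, t.refl y⟩

theorem numClasses_lt {s t : Setoid X} (h : s ≤ t) {a b : X} (hab : t a b) (hs : ¬ s a b) :
    t.numClasses < s.numClasses := by
  refine lt_of_le_of_ne (numClasses_anti h) fun he => hs ?_
  let f : Quotient s → Quotient t := Quotient.map id (fun _ _ hab => h hab)
  have hf : Function.Surjective f := by
    intro q
    induction q using Quotient.inductionOn with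
    | h y => exact ⟨Quotient.mk _ y, rfl⟩
  have hinj := ((Nat.bijective_iff_surjective_and_card f).2 ⟨hf, he.symm⟩).1
  have : f (Quotient.mk _ a) = f (Quotient.mk _ b) := Quotient.sound hab
  exact Quotient.exact (hinj this)

/-- The hypothesis bounds `t` by the join of `s` with the single pair `(a, b)`, and merging two
classes of `s` loses at most one class. Stated with a universally quantified `r`, it can be checked
on generators. -/
theorem numClasses_le_add_one {s t : Setoid X} {a b : X}
    (h : ∀ r : Setoid X, s ≤ r → r a b → t ≤ r) : s.numClasses ≤ t.numClasses + 1 := by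
  classical
  by_contra hlt
  push Not at hlt
  let r : Setoid X :=
    { r := fun x y => s x y ∨ ((s x a ∨ s x b) ∧ (s y a ∨ s y b))
      iseqv :=
        { refl := fun x => Or.inl (s.refl x)
          symm := fun {x y} hxy => hxy.imp s.symm And.symm
          trans := fun {x y z} hxy hyz => by
            rcases hxy with hxy | ⟨h1, h2⟩ <;> rcases hyz with hyz | ⟨h3, h4⟩
            · exact Or.inl (s.trans hxy hyz)
            · exact Or.inr ⟨h3.imp (s.trans hxy) (s.trans hxy), h4⟩
            · exact Or.inr ⟨h1, h2.imp (s.trans (s.symm hyz)) (s.trans (s.symm hyz))⟩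
            · exact Or.inr ⟨h1, h4⟩ } }
  have hr : t ≤ r := h r (fun {x y} hxy => Or.inl hxy)
    (Or.inr ⟨Or.inl (s.refl a), Or.inr (s.refl b)⟩)
  have hrt := numClasses_anti hr
  suffices hsr : s.numClasses ≤ r.numClasses + 1 by omega
  let f : Quotient s → Option (Quotient r) := fun q =>
    if q = Quotient.mk _ a then none
    else some (Quotient.map id (fun _ _ hab => Or.inl hab) q)
  have hf : Function.Injective f := by
    intro p q hpq
    induction p using Quotient.inductionOn with | h x =>
    induction q using Quotient.inductionOn with | h y =>
    simp only [f] at hpq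
    split_ifs at hpq with h1 h2 h2
    · rw [h1, h2]
    · have hxy : r x y := Quotient.exact (Option.some_injective _ hpq)
      have h1' : ¬ s x a := fun h => h1 (Quotient.sound h)
      have h2' : ¬ s y a := fun h => h2 (Quotient.sound h)
      apply Quotient.sound
      rcases hxy with hxy | ⟨h3, h4⟩
      · exact hxy
      · exact s.trans (h3.resolve_left h1') (s.symm (h4.resolve_left h2'))
  have := Nat.card_le_card_of_injective f hf
  rw [Finite.card_option] at this
  exact this

/-- The number of classes of a setoid that meet a set. -/
noncomputable def numClassesOn (s : Setoid X) (Z : Set X) : ℕ := (Quotient.mk s '' Z).ncard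

theorem numClasses_eq_add (s : Setoid X) {Z : Set X} (hZ : ∀ a b, s a b → a ∈ Z → b ∈ Z) :
    s.numClasses = s.numClassesOn Z + s.numClassesOn Zᶜ := by
  rw [numClassesOn, numClassesOn, ← Set.ncard_union_eq, ← Set.image_union, Set.union_compl_self,
    Set.image_univ, Set.range_eq_univ.2 Quotient.mk_surjective, Set.ncard_univ, numClasses]
  rw [Set.disjoint_left]
  rintro _ ⟨a, ha, rfl⟩ ⟨b, hb, hab⟩
  exact hb (hZ a b (s.symm (Quotient.exact hab)) ha)

theorem numClassesOn_congr {s t : Setoid X} {Z : Set X}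
    (h : ∀ a ∈ Z, ∀ b ∈ Z, s a b ↔ t a b) : s.numClassesOn Z = t.numClassesOn Z := by
  have key : ∀ {s t : Setoid X}, (∀ a ∈ Z, ∀ b ∈ Z, s a b ↔ t a b) →
      s.numClassesOn Z ≤ t.numClassesOn Z := by
    intro s t h
    have hsurj : ∀ q : (Quotient.mk s '' Z : Set (Quotient s)), ∃ a ∈ Z, Quotient.mk s a = q.1 :=
      fun q => q.2
    choose g hg hgq using hsurj
    refine Nat.card_le_card_of_injective
      (fun q => (⟨Quotient.mk t (g q), g q, hg q, rfl⟩ : (Quotient.mk t '' Z : Set _))) ?_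
    intro p q hpq
    have hpq' : t (g p) (g q) := Quotient.exact (congrArg Subtype.val hpq)
    apply Subtype.ext
    rw [← hgq p, ← hgq q]
    exact Quotient.sound ((h _ (hg p) _ (hg q)).2 hpq')
  exact le_antisymm (key h) (key fun a ha b hb => (h a ha b hb).symm)

end Setoid

/-! ### Fixed-point-free involutions and orbits -/

section Orbits

variable {X : Type u}

theorem even_ncard_of_involution [Finite X] {f : X → X} (hf : ∀ x, f (f x) = x)
    (hne : ∀ x, f x ≠ x) {Z : Set X} (hZ : ∀ z ∈ Z, f z ∈ Z) : Even Z.ncard := by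
  classical
  have := Fintype.ofFinite X
  rw [Set.ncard_eq_toFinset_card' Z, ← ZMod.natCast_eq_zero_iff_even, Finset.cast_card]
  refine Finset.sum_involution (fun x _ => f x) ?_ ?_ ?_ ?_
  · intros; decide
  · intro a _ _; exact hne a
  · intro a ha; simpa using hZ a (by simpa using ha)
  · intro a _; exact hf a

/-- If a set is closed under one of two fixed-point-free involutions, then the other one
leaves it at an even number of points. -/
theorem even_ncard_exits [Finite X] {f g : X → X} (hf : ∀ x, f (f x) = x) (hfne : ∀ x, f x ≠ x)
    (hg : ∀ x, g (g x) = x) (hgne : ∀ x, g x ≠ x) {Z : Set X} (hZ : ∀ z ∈ Z, g z ∈ Z) :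
    Even {z ∈ Z | f z ∉ Z}.ncard := by
  have h1 := even_ncard_of_involution hg hgne hZ
  have h2 : Even {z ∈ Z | f z ∈ Z}.ncard :=
    even_ncard_of_involution hf hfne fun z hz => ⟨hz.2, by rw [hf]; exact hz.1⟩
  have h3 := Set.ncard_inter_add_ncard_sdiff_eq_ncard Z {z | f z ∈ Z} (Set.toFinite _)
  have h4 : Z ∩ {z | f z ∈ Z} = {z ∈ Z | f z ∈ Z} := rfl
  have h5 : Z \ {z | f z ∈ Z} = {z ∈ Z | f z ∉ Z} := rfl
  rw [h4, h5] at h3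
  rw [← h3] at h1
  exact (Nat.even_add.1 h1).1 h2

/-- Exits are even in number, so one forces another. This parity argument replaces tracing a
boundary arc from `x` until it leaves `Z`. -/
theorem exists_exit_ne [Finite X] {f g : X → X} (hf : ∀ x, f (f x) = x) (hfne : ∀ x, f x ≠ x)
    (hg : ∀ x, g (g x) = x) (hgne : ∀ x, g x ≠ x) {Z : Set X} (hZ : ∀ z ∈ Z, g z ∈ Z) {x : X}
    (hx : x ∈ Z) (hfx : f x ∉ Z) : ∃ y ∈ Z, f y ∉ Z ∧ y ≠ x := by
  by_contra! h
  have : {z ∈ Z | f z ∉ Z} = {x} := by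
    ext z
    simp only [Set.mem_ofPred_eq, Set.mem_singleton_iff]
    exact ⟨fun hz => h z hz.1 hz.2, fun hz => hz ▸ ⟨hx, hfx⟩⟩
  have he := even_ncard_exits hf hfne hg hgne hZ
  rw [this, Set.ncard_singleton] at he
  exact absurd he (by decide)

theorem eqvGen_setoid_le {r : X → X → Prop} {s : Setoid X} (h : ∀ a b, r a b → s a b) :
    Relation.EqvGen.setoid r ≤ s := by
  intro a b hab
  induction hab with
  | rel a b h' => exact h a b h'
  | refl a => exact s.refl a
  | symm a b _ ih => exact s.symm ih
  | trans a b c _ _ ih1 ih2 => exact s.trans ih1 ih2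

theorem mem_iff_of_eqvGen {r : X → X → Prop} {Z : Set X} (h : ∀ a b, r a b → (a ∈ Z ↔ b ∈ Z))
    {a b : X} (hab : Relation.EqvGen.setoid r a b) : a ∈ Z ↔ b ∈ Z := by
  let s : Setoid X := ⟨fun a b => a ∈ Z ↔ b ∈ Z, fun _ => Iff.rfl, Iff.symm, Iff.trans⟩
  exact (eqvGen_setoid_le (s := s) h) hab

/-- A chain of `r`-steps that starts in `Z` never leaves `Z`, so each of its steps can be imitated
in `r'`. -/
theorem eqvGen_congr_on {r r' : X → X → Prop} {Z : Set X} (h : ∀ a b, r a b → (a ∈ Z ↔ b ∈ Z))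
    (hr : ∀ a ∈ Z, ∀ b, r a b → Relation.EqvGen.setoid r' a b) {a b : X} (ha : a ∈ Z)
    (hab : Relation.EqvGen.setoid r a b) : Relation.EqvGen.setoid r' a b := by
  let s : Setoid X :=
    { r := fun a b => (a ∈ Z ↔ b ∈ Z) ∧ (a ∈ Z → Relation.EqvGen.setoid r' a b)
      iseqv :=
        { refl := fun a => ⟨Iff.rfl, fun _ => Setoid.refl' _ a⟩
          symm := fun {a b} h => ⟨h.1.symm, fun hb => Setoid.symm' _ (h.2 (h.1.2 hb))⟩
          trans := fun {a b c} h h' =>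
            ⟨h.1.trans h'.1, fun ha => Setoid.trans' _ (h.2 ha) (h'.2 (h.1.1 ha))⟩ } }
  exact ((eqvGen_setoid_le (s := s) fun a b hab => ⟨h a b hab, fun ha => hr a ha b hab⟩) hab).2 ha

theorem orbitSetoid_left (f g : X → X) (x : X) : orbitSetoid f g x (f x) :=
  Relation.EqvGen.rel _ _ (Or.inl rfl)

theorem orbitSetoid_right (f g : X → X) (x : X) : orbitSetoid f g x (g x) :=
  Relation.EqvGen.rel _ _ (Or.inr rfl)

theorem orbitSetoid_le {f g : X → X} {s : Setoid X} (hf : ∀ x, s x (f x)) (hg : ∀ x, s x (g x)) :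
    orbitSetoid f g ≤ s := by
  refine eqvGen_setoid_le ?_
  rintro a b (rfl | rfl)
  exacts [hf a, hg a]

theorem mem_iff_of_involutive {f : X → X} (hf : ∀ x, f (f x) = x) {Z : Set X}
    (h : ∀ z ∈ Z, f z ∈ Z) (a : X) : a ∈ Z ↔ f a ∈ Z :=
  ⟨h a, fun ha => hf a ▸ h _ ha⟩

theorem orbitSetoid_mem {f g : X → X} (hf : ∀ x, f (f x) = x) (hg : ∀ x, g (g x) = x) {Z : Set X}
    (hfZ : ∀ z ∈ Z, f z ∈ Z) (hgZ : ∀ z ∈ Z, g z ∈ Z) {a b : X} (hab : orbitSetoid f g a b)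
    (ha : a ∈ Z) : b ∈ Z := by
  refine (mem_iff_of_eqvGen (Z := Z) ?_ hab).1 ha
  rintro a b (rfl | rfl)
  exacts [mem_iff_of_involutive hf hfZ a, mem_iff_of_involutive hg hgZ a]

theorem orbitSetoid_congr_on {f g f' g' : X → X} (hf : ∀ x, f (f x) = x) (hg : ∀ x, g (g x) = x)
    {Z : Set X} (hfZ : ∀ z ∈ Z, f z ∈ Z) (hgZ : ∀ z ∈ Z, g z ∈ Z) (hff : ∀ z ∈ Z, f' z = f z)
    (hgg : ∀ z ∈ Z, g' z = g z) {a b : X} (ha : a ∈ Z) (hab : orbitSetoid f g a b) :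
    orbitSetoid f' g' a b := by
  refine eqvGen_congr_on (Z := Z) ?_ ?_ ha hab
  · rintro a b (rfl | rfl)
    exacts [mem_iff_of_involutive hf hfZ a, mem_iff_of_involutive hg hgZ a]
  · rintro a ha b (rfl | rfl)
    · rw [← hff a ha]; exact orbitSetoid_left _ _ _
    · rw [← hgg a ha]; exact orbitSetoid_right _ _ _

theorem orbitSetoid_self_iff {f : X → X} (hf : ∀ x, f (f x) = x) (a b : X) :
    orbitSetoid f f a b ↔ b = a ∨ b = f a := by
  constructor
  · intro hab
    have := orbitSetoid_mem (Z := {a, f a}) hf hf (by rintro z (rfl | rfl) <;> simp [hf])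
      (by rintro z (rfl | rfl) <;> simp [hf]) hab (by simp)
    simpa using this
  · rintro (rfl | rfl)
    exacts [Setoid.refl' _ _, orbitSetoid_left _ _ _]

theorem two_mul_numClasses_involution [Finite X] {f : X → X} (hf : ∀ x, f (f x) = x)
    (hne : ∀ x, f x ≠ x) : 2 * (orbitSetoid f f).numClasses = Nat.card X := by
  classical
  have := Fintype.ofFinite X
  have := Fintype.ofFinite (Quotient (orbitSetoid f f))
  have hrel := orbitSetoid_self_iff hf
  rw [Setoid.numClasses, Nat.card_eq_fintype_card, Nat.card_eq_fintype_card, ← Finset.card_univ,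
    ← Finset.card_univ (α := X),
    Finset.card_eq_sum_card_fiberwise (f := Quotient.mk (orbitSetoid f f)) (t := Finset.univ)
      (fun _ _ => Finset.mem_coe.2 (Finset.mem_univ _)),
    Finset.sum_const_nat (m := 2), mul_comm]
  intro q _
  induction q using Quotient.inductionOn with | h a =>
  have : (Finset.univ.filter fun x => Quotient.mk (orbitSetoid f f) x = Quotient.mk _ a)
      = {a, f a} := by
    ext x
    simp only [Finset.mem_filter, Finset.mem_univ, true_and, Finset.mem_insert,
      Finset.mem_singleton, Quotient.eq]
    rw [← hrel]
    exact ⟨Setoid.symm' _, Setoid.symm' _⟩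
  rw [this, Finset.card_pair (hne a).symm]

end Orbits

/-! ### Nonnegativity and monotonicity of the Euler genus of spanning ribbon subgraphs -/

namespace RibbonGraph

variable (G : RibbonGraph.{u})

instance : Finite G.V := G.finite_V
instance : Finite G.E := G.finite_E
instance : Finite G.Flag := G.finite_Flag

variable {G}

theorem along_of_mem {A : Set G.E} {x : G.Flag} (h : G.edge x ∈ A) : G.along A x = G.τ₀ x :=
  if_pos h

theorem along_of_notMem {A : Set G.E} {x : G.Flag} (h : G.edge x ∉ A) : G.along A x = G.τ₂ x :=
  if_neg h

theorem along_congr {A B : Set G.E} {x : G.Flag} (h : G.edge x ∈ A ↔ G.edge x ∈ B) :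
    G.along A x = G.along B x := by
  by_cases hA : G.edge x ∈ A
  · rw [along_of_mem hA, along_of_mem (h.1 hA)]
  · rw [along_of_notMem hA, along_of_notMem (mt h.2 hA)]

theorem along_along (A : Set G.E) (x : G.Flag) : G.along A (G.along A x) = x := by
  by_cases h : G.edge x ∈ A <;> simp [along, h, edge_τ₀, edge_τ₂, G.invol₀, G.invol₂]

theorem along_ne (A : Set G.E) (x : G.Flag) : G.along A x ≠ x := by
  by_cases h : G.edge x ∈ A <;> simp [along, h, G.ne₀, G.ne₂]

theorem along_empty : G.along ∅ = G.τ₂ := funext fun _ => if_neg (Set.notMem_empty _)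

theorem vert_τ₁ (x : G.Flag) : G.vert (G.τ₁ x) = G.vert x :=
  ((G.vert_eq_iff _ _).2 (orbitSetoid_left _ _ _)).symm

theorem vert_τ₂ (x : G.Flag) : G.vert (G.τ₂ x) = G.vert x :=
  ((G.vert_eq_iff _ _).2 (orbitSetoid_right _ _ _)).symm

variable (G)

/-- The boundary components of the spanning ribbon subgraph with edge set `B` that carry flags. -/
noncomputable def bdry (B : Set G.E) : Setoid G.Flag := orbitSetoid G.τ₁ (G.along B)

/-- The flags that lie on the same component of the spanning ribbon subgraph with edge
set `B`. -/
def comps (B : Set G.E) : Setoid G.Flag :=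
  Relation.EqvGen.setoid fun x y => y = G.τ₁ x ∨ y = G.τ₂ x ∨ (G.edge x ∈ B ∧ y = G.τ₀ x)

variable {G}

theorem bdry_τ₁ (B : Set G.E) (x : G.Flag) : G.bdry B x (G.τ₁ x) := orbitSetoid_left _ _ _

theorem bdry_along (B : Set G.E) (x : G.Flag) : G.bdry B x (G.along B x) :=
  orbitSetoid_right _ _ _

theorem comps_τ₁ (B : Set G.E) (x : G.Flag) : G.comps B x (G.τ₁ x) :=
  Relation.EqvGen.rel _ _ (Or.inl rfl)

theorem comps_τ₂ (B : Set G.E) (x : G.Flag) : G.comps B x (G.τ₂ x) :=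
  Relation.EqvGen.rel _ _ (Or.inr (Or.inl rfl))

theorem comps_τ₀ {B : Set G.E} {x : G.Flag} (h : G.edge x ∈ B) : G.comps B x (G.τ₀ x) :=
  Relation.EqvGen.rel _ _ (Or.inr (Or.inr ⟨h, rfl⟩))

theorem bdry_le {B : Set G.E} {s : Setoid G.Flag} (h₁ : ∀ x, s x (G.τ₁ x))
    (h : ∀ x, s x (G.along B x)) : G.bdry B ≤ s := orbitSetoid_le h₁ h

theorem comps_le {B : Set G.E} {s : Setoid G.Flag} (h₁ : ∀ x, s x (G.τ₁ x))
    (h₂ : ∀ x, s x (G.τ₂ x)) (h₀ : ∀ x, G.edge x ∈ B → s x (G.τ₀ x)) : G.comps B ≤ s := by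
  refine eqvGen_setoid_le ?_
  rintro a b (rfl | rfl | ⟨h, rfl⟩)
  exacts [h₁ a, h₂ a, h₀ a h]

theorem comps_mem {B : Set G.E} {Z : Set G.Flag} (h₁ : ∀ x ∈ Z, G.τ₁ x ∈ Z)
    (h₂ : ∀ x ∈ Z, G.τ₂ x ∈ Z) (h₀ : ∀ x ∈ Z, G.edge x ∈ B → G.τ₀ x ∈ Z) {a b : G.Flag}
    (hab : G.comps B a b) (ha : a ∈ Z) : b ∈ Z := by
  refine (mem_iff_of_eqvGen (Z := Z) ?_ hab).1 ha
  rintro a b (rfl | rfl | ⟨h, rfl⟩)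
  · exact mem_iff_of_involutive G.invol₁ h₁ a
  · exact mem_iff_of_involutive G.invol₂ h₂ a
  · exact ⟨fun ha => h₀ a ha h, fun ha => by
      simpa [G.invol₀] using h₀ _ ha (by rwa [edge_τ₀])⟩

theorem comps_congr_on {B : Set G.E} {Z : Set G.Flag}
    (h₁ : ∀ x ∈ Z, G.τ₁ x ∈ Z) (h₂ : ∀ x ∈ Z, G.τ₂ x ∈ Z)
    (h₀ : ∀ x ∈ Z, G.edge x ∈ B → G.τ₀ x ∈ Z) {s : Setoid G.Flag}
    (hs₁ : ∀ x ∈ Z, s x (G.τ₁ x)) (hs₂ : ∀ x ∈ Z, s x (G.τ₂ x))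
    (hs₀ : ∀ x ∈ Z, G.edge x ∈ B → s x (G.τ₀ x)) {a b : G.Flag}
    (ha : a ∈ Z) (hab : G.comps B a b) : s a b := by
  have he : Relation.EqvGen.setoid (fun x y => s x y) ≤ s := eqvGen_setoid_le fun _ _ h => h
  refine he (eqvGen_congr_on (Z := Z) ?_ ?_ ha hab)
  · rintro a b (rfl | rfl | ⟨h, rfl⟩)
    · exact mem_iff_of_involutive G.invol₁ h₁ a
    · exact mem_iff_of_involutive G.invol₂ h₂ a
    · exact ⟨fun ha => h₀ a ha h, fun ha => by
        simpa [G.invol₀] using h₀ _ ha (by rwa [edge_τ₀])⟩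
  · rintro a ha b (rfl | rfl | ⟨h, rfl⟩)
    exacts [Relation.EqvGen.rel _ _ (hs₁ a ha), Relation.EqvGen.rel _ _ (hs₂ a ha),
      Relation.EqvGen.rel _ _ (hs₀ a ha h)]

theorem bdry_le_comps (B : Set G.E) : G.bdry B ≤ G.comps B := by
  refine bdry_le (comps_τ₁ B) fun x => ?_
  by_cases h : G.edge x ∈ B
  · rw [along_of_mem h]; exact comps_τ₀ h
  · rw [along_of_notMem h]; exact comps_τ₂ B x

theorem comps_empty : G.comps ∅ = G.bdry ∅ :=
  le_antisymm (comps_le (bdry_τ₁ ∅) (fun x => by simpa [along_empty] using bdry_along ∅ x)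
    fun _ h => h.elim) (bdry_le_comps ∅)

theorem comps_mono {B C : Set G.E} (h : B ⊆ C) : G.comps B ≤ G.comps C :=
  comps_le (comps_τ₁ C) (comps_τ₂ C) fun _ hx => comps_τ₀ (h hx)

theorem edge_eq_cases {x y : G.Flag} (h : G.edge y = G.edge x) :
    y = x ∨ y = G.τ₀ x ∨ y = G.τ₂ x ∨ y = G.τ₀ (G.τ₂ x) := (G.edge_eq_iff x y).1 h.symm

/-- The quantity 2k + |B| - f does not decrease when an edge is added. If the edge has both ends on
one component, k is unchanged and f grows by at most one. If it joins two components, k drops by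
one, but two boundary components merge, so f drops as well. -/
theorem genus_bound_insert {B : Set G.E} {e : G.E} (he : e ∉ B) :
    2 * (G.comps B).numClasses + (G.bdry (insert e B)).numClasses ≤
      2 * (G.comps (insert e B)).numClasses + 1 + (G.bdry B).numClasses := by
  obtain ⟨x, rfl⟩ := G.edge_surjective e
  set B' := insert (G.edge x) B with hB'
  have hin : ∀ y, G.edge y = G.edge x → G.along B' y = G.τ₀ y := fun y hy =>
    along_of_mem (by rw [hy]; exact Set.mem_insert _ _)
  have hnin : ∀ y, G.edge y = G.edge x → G.along B y = G.τ₂ y := fun y hy =>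
    along_of_notMem (by rw [hy]; exact he)
  have hoff : ∀ y, G.edge y ≠ G.edge x → G.along B' y = G.along B y := fun y hy => by
    have : G.edge y ∈ B' ↔ G.edge y ∈ B := by simp [hB', hy]
    by_cases h : G.edge y ∈ B
    · rw [along_of_mem h, along_of_mem (this.2 h)]
    · rw [along_of_notMem h, along_of_notMem (mt this.1 h)]
  have e02 : G.edge (G.τ₂ x) = G.edge x := edge_τ₂ G x
  have e00 : G.edge (G.τ₀ x) = G.edge x := edge_τ₀ G x
  -- a relation containing one smoothing at the edge and one more pair contains the other
  have hle : ∀ r : Setoid G.Flag, G.bdry B' ≤ r → r x (G.τ₂ x) → G.bdry B ≤ r := by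
    intro r hr hx
    refine bdry_le (fun y => hr (bdry_τ₁ _ y)) fun y => ?_
    have r0 : ∀ y, G.edge y = G.edge x → r y (G.τ₀ y) := fun y hy =>
      hr (hin y hy ▸ bdry_along B' y)
    have r1 := r0 x rfl
    have r2 := r0 _ e02
    by_cases hy : G.edge y = G.edge x
    · rw [hnin y hy]
      rcases edge_eq_cases hy with rfl | rfl | rfl | rfl
      · exact hx
      · rw [← G.comm]; exact r.trans (r.symm r1) (r.trans hx r2)
      · rw [G.invol₂]; exact r.symm hx
      · rw [← G.comm, G.invol₂]; exact r.trans (r.symm r2) (r.trans (r.symm hx) r1)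
    · rw [← hoff y hy]; exact hr (bdry_along _ y)
  have hk : (G.comps B).numClasses ≤ (G.comps B').numClasses + 1 := by
    refine Setoid.numClasses_le_add_one (a := x) (b := G.τ₀ x) fun r hr hx => ?_
    have r2 : ∀ y, r y (G.τ₂ y) := fun y => hr (comps_τ₂ B y)
    refine comps_le (fun y => hr (comps_τ₁ B y)) r2 fun y hy => ?_
    rcases hy with hy | hy
    · rcases edge_eq_cases hy with rfl | rfl | rfl | rfl
      · exact hx
      · rw [G.invol₀]; exact r.symm hx
      · rw [G.comm]; exact r.trans (r.symm (r2 _)) (r.trans hx (r2 _))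
      · rw [G.invol₀, G.comm]; exact r.trans (r.symm (r2 _)) (r.trans (r.symm hx) (r2 _))
    · exact hr (comps_τ₀ hy)
  by_cases hx : G.comps B x (G.τ₀ x)
  · have hk' : (G.comps B).numClasses ≤ (G.comps B').numClasses := by
      refine Setoid.numClasses_anti (comps_le (comps_τ₁ B) (comps_τ₂ B) fun y hy => ?_)
      have r2 := comps_τ₂ B
      rcases hy with hy | hy
      · rcases edge_eq_cases hy with rfl | rfl | rfl | rfl
        · exact hx
        · rw [G.invol₀]; exact Setoid.symm' _ hx
        · rw [G.comm]
          exact Setoid.trans' _ (Setoid.symm' _ (r2 _)) (Setoid.trans' _ hx (r2 _))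
        · rw [G.invol₀, G.comm]
          exact Setoid.trans' _ (Setoid.symm' _ (r2 _))
            (Setoid.trans' _ (Setoid.symm' _ hx) (r2 _))
      · exact comps_τ₀ hy
    have h1 : (G.bdry B').numClasses ≤ (G.bdry B ⊔ G.bdry B').numClasses + 1 :=
      Setoid.numClasses_le_add_one (a := x) (b := G.τ₂ x) fun r hr hx =>
        sup_le (hle r hr hx) hr
    have h2 : (G.bdry B ⊔ G.bdry B').numClasses ≤ (G.bdry B).numClasses :=
      Setoid.numClasses_anti le_sup_left
    omega
  · -- the walk around the boundary component of `x` reconnects the two ends of the new edge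
    have hx2 : G.bdry B' x (G.τ₂ x) := by
      by_contra hcon
      -- `D` is closed under `τ₁`, and away from the new edge it is also closed under `along B`. So
      -- its second exit lies on the new edge; the side partners of `x` and `τ₂ x` are on another
      -- component, which leaves only `τ₂ x`.
      let D : Set G.Flag := {y | G.bdry B x y ∧ G.bdry B' x y}
      have hDx : x ∈ D := ⟨Setoid.refl' _ _, Setoid.refl' _ _⟩
      have hD1 : ∀ y ∈ D, G.τ₁ y ∈ D := fun y hy =>
        ⟨Setoid.trans' _ hy.1 (bdry_τ₁ _ _), Setoid.trans' _ hy.2 (bdry_τ₁ _ _)⟩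
      obtain ⟨y, hy, hy', hyx⟩ := exists_exit_ne (along_along B) (along_ne B) G.invol₁ G.ne₁ hD1
        hDx (fun h => hcon (by rw [hnin x rfl] at h; exact h.2))
      have hye : G.edge y ≠ G.edge x := by
        intro hye
        have hxy := bdry_le_comps B hy.1
        rcases edge_eq_cases hye with rfl | rfl | rfl | rfl
        · exact hyx rfl
        · exact hx hxy
        · exact hcon hy.2
        · rw [G.comm] at hxy
          exact hx (Setoid.trans' _ hxy (Setoid.symm' _ (comps_τ₂ B _)))
      exact hy' ⟨Setoid.trans' _ hy.1 (bdry_along _ _),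
        Setoid.trans' _ hy.2 (hoff y hye ▸ bdry_along B' y)⟩
    have hlt := Setoid.numClasses_lt (hle _ le_rfl hx2) (a := x) (b := G.τ₀ x)
      (hin x rfl ▸ bdry_along B' x) (fun h => hx (bdry_le_comps B h))
    omega

/-- The Euler genus of spanning ribbon subgraphs is monotone. -/
theorem genus_bound_mono {B C : Set G.E} (h : B ⊆ C) :
    2 * (G.comps B).numClasses + B.ncard + (G.bdry C).numClasses ≤
      2 * (G.comps C).numClasses + C.ncard + (G.bdry B).numClasses := by
  have key : ∀ D : Set G.E, Disjoint B D →
      2 * (G.comps B).numClasses + B.ncard + (G.bdry (B ∪ D)).numClasses ≤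
      2 * (G.comps (B ∪ D)).numClasses + (B ∪ D).ncard + (G.bdry B).numClasses := by
    intro D
    induction D, D.toFinite using Set.Finite.induction_on with
    | empty => simp
    | @insert e D he _ ih =>
      intro hd
      rw [Set.disjoint_insert_right] at hd
      have hn : e ∉ B ∪ D := fun h => h.elim hd.1 he
      have h1 := ih hd.2
      have h2 := genus_bound_insert hn
      rw [Set.union_insert, Set.ncard_insert_of_notMem hn]
      omega
  have := key (C \ B) Set.disjoint_sdiff_right
  rwa [Set.union_sdiff_cancel h] at this

theorem genus_bound (C : Set G.E) :
    (G.bdry ∅).numClasses + (G.bdry C).numClasses ≤ 2 * (G.comps C).numClasses + C.ncard := by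
  have := genus_bound_mono (Set.empty_subset C)
  rw [comps_empty, Set.ncard_empty] at this
  omega

theorem bdry_partialDual_empty (A : Set G.E) : (G.partialDual A).bdry ∅ = G.bdry A := by
  unfold bdry
  rw [along_empty]
  rfl

/-- Dualizing at an edge of `A` exchanges its ends and sides, so a boundary walk that follows the
dual sides of such an edge follows its original ends. -/
theorem bdry_partialDual {S A : Set G.E} (h : A ⊆ S) :
    (G.partialDual A).bdry S = G.bdry (S \ A) := by
  have : (G.partialDual A).along S = G.along (S \ A) := by
    funext x
    by_cases hS : G.edge x ∈ S
    · refine (along_of_mem (G := G.partialDual A) hS).trans ?_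
      by_cases hA : G.edge x ∈ A
      · exact (if_pos hA : G.coAlong A x = _).trans
          (along_of_notMem fun hx : G.edge x ∈ S \ A => hx.2 hA).symm
      · exact (if_neg hA : G.coAlong A x = _).trans
          (along_of_mem (show G.edge x ∈ S \ A from ⟨hS, hA⟩)).symm
    · refine (along_of_notMem (G := G.partialDual A) hS).trans ?_
      exact (if_neg (mt (@h _) hS) : G.along A x = _).trans
        (along_of_notMem fun hx : G.edge x ∈ S \ A => hS hx.1).symm
  unfold bdry
  rw [this]
  rfl

/-- On an edge of `S` both `τ₀` and `τ₂` stay within the component, so it does not matter that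
dualizing swaps them; on the other edges nothing is changed. -/
theorem comps_le_partialDual {S A : Set G.E} (h : A ⊆ S) :
    G.comps S ≤ (G.partialDual A).comps S := by
  let G' := G.partialDual A
  have k2 : ∀ x : G.Flag, G'.comps S x (G.along A x) := comps_τ₂ (G := G') S
  have k0 : ∀ x : G.Flag, G.edge x ∈ S → G'.comps S x (G.coAlong A x) :=
    fun x hx => comps_τ₀ (G := G') hx
  refine comps_le (comps_τ₁ (G := G') S) (fun x => ?_) fun x hx => ?_
  · by_cases hA : G.edge x ∈ A
    · have := k0 x (h hA); rwa [coAlong, if_pos hA] at this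
    · have := k2 x; rwa [along, if_neg hA] at this
  · by_cases hA : G.edge x ∈ A
    · have := k2 x; rwa [along, if_pos hA] at this
    · have := k0 x hx; rwa [coAlong, if_neg hA] at this

/-- This is `genus_bound` for the partial dual with respect to `S ∩ A`, whose vertices are counted
by the boundary components of `S ∩ A`, and the boundary components of whose spanning subgraph `S`
are those of `S \ A`. -/
theorem genus_bound_partialDual (S A : Set G.E) :
    (G.bdry (S ∩ A)).numClasses + (G.bdry (S \ A)).numClasses ≤
      2 * (G.comps S).numClasses + S.ncard := by
  have key := genus_bound (G := G.partialDual (S ∩ A)) S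
  rw [bdry_partialDual_empty, bdry_partialDual Set.inter_subset_left,
    Set.sdiff_self_inter] at key
  have h : ((G.partialDual (S ∩ A)).comps S).numClasses ≤ (G.comps S).numClasses :=
    Setoid.numClasses_anti (comps_le_partialDual Set.inter_subset_left)
  exact key.trans (Nat.add_le_add_right (Nat.mul_le_mul_left 2 h) _)

end RibbonGraph

/-! ### Regluing two corners -/

section Reglue

variable {X : Type u}

/-- `x` and `y` are the points at which the map `f` leaves the set `Y`. -/
structure HasExits (f : X → X) (Y : Set X) (x y : X) : Prop where
  ne : x ≠ y
  left_mem : x ∈ Y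
  right_mem : y ∈ Y
  left_exit : f x ∉ Y
  right_exit : f y ∉ Y
  eq_or_eq : ∀ z ∈ Y, f z ∉ Y → z = x ∨ z = y

namespace HasExits

variable {f g : X → X} {Y : Set X} {x y : X}

theorem setOf_eq (h : HasExits f Y x y) : {z ∈ Y | f z ∉ Y} = {x, y} := by
  ext z
  refine ⟨fun hz => h.eq_or_eq z hz.1 hz.2, ?_⟩
  rintro (rfl | rfl)
  exacts [⟨h.left_mem, h.left_exit⟩, ⟨h.right_mem, h.right_exit⟩]

theorem of_setOf_eq (hne : x ≠ y) (h : {z ∈ Y | f z ∉ Y} = {x, y}) : HasExits f Y x y := by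
  have hx : x ∈ {z ∈ Y | f z ∉ Y} := h ▸ Set.mem_insert _ _
  have hy : y ∈ {z ∈ Y | f z ∉ Y} := h ▸ Set.mem_insert_of_mem _ rfl
  exact ⟨hne, hx.1, hy.1, hx.2, hy.2, fun z h1 h2 =>
    show z ∈ ({x, y} : Set X) from h ▸ (⟨h1, h2⟩ : z ∈ {z ∈ Y | f z ∉ Y})⟩

theorem exists_of_ncard (h : {z ∈ Y | f z ∉ Y}.ncard = 2) : ∃ x y, HasExits f Y x y := by
  obtain ⟨x, y, hne, h⟩ := Set.ncard_eq_two.1 h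
  exact ⟨x, y, of_setOf_eq hne h⟩

theorem ncard (h : HasExits f Y x y) : {z ∈ Y | f z ∉ Y}.ncard = 2 := by
  rw [h.setOf_eq, Set.ncard_pair h.ne]

theorem compl (h : HasExits f Y x y) (hf : ∀ z, f (f z) = z) : HasExits f Yᶜ (f x) (f y) where
  ne he := h.ne (by rw [← hf x, he, hf])
  left_mem := h.left_exit
  right_mem := h.right_exit
  left_exit := by simpa [hf] using h.left_mem
  right_exit := by simpa [hf] using h.right_mem
  eq_or_eq z hz hfz := by
    rcases h.eq_or_eq (f z) (not_not.1 hfz) (by rwa [hf]) with h' | h'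
    exacts [Or.inl (by rw [← h', hf]), Or.inr (by rw [← h', hf])]

theorem right_ne (h : HasExits f Y x y) : y ≠ f x := fun he => h.left_exit (he ▸ h.right_mem)

theorem left_ne (h : HasExits f Y x y) : x ≠ f y := fun he => h.right_exit (he ▸ h.left_mem)

/-- The two exits are joined within the set. -/
theorem connected [Finite X] (h : HasExits f Y x y) (hf : ∀ x, f (f x) = x)
    (hfne : ∀ x, f x ≠ x) (hg : ∀ x, g (g x) = x) (hgne : ∀ x, g x ≠ x)
    (hY : ∀ z ∈ Y, g z ∈ Y) {s : Setoid X} (hsg : ∀ z, s z (g z))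
    (hsf : ∀ z ∈ Y, f z ∈ Y → s z (f z)) : s x y := by
  let D : Set X := {z ∈ Y | s x z}
  obtain ⟨z, hz, hfz, hzx⟩ := exists_exit_ne hf hfne hg hgne
    (Z := D) (fun z hz => ⟨hY z hz.1, s.trans hz.2 (hsg z)⟩) (x := x)
    ⟨h.left_mem, s.refl x⟩ (fun h' => h.left_exit h'.1)
  have : f z ∉ Y := fun h' => hfz ⟨h', s.trans hz.2 (hsf z hz.1 h')⟩
  rcases h.eq_or_eq z hz.1 this with rfl | rfl
  exacts [absurd rfl hzx, hz.2]

end HasExits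

open Classical in
/-- Change the involution `f` so that it exchanges `x` with `y` and `f x` with `f y`. -/
noncomputable def reglue (f : X → X) (x y z : X) : X :=
  if z = x then y else if z = y then x else if z = f x then f y else if z = f y then f x else f z

variable {f g : X → X} {Y : Set X} {x y : X}

theorem reglue_cases (f : X → X) (x y z : X) :
    (z = x ∧ reglue f x y z = y) ∨ (z = y ∧ reglue f x y z = x) ∨
    (z = f x ∧ reglue f x y z = f y) ∨ (z = f y ∧ reglue f x y z = f x) ∨
    ((z ≠ x ∧ z ≠ y ∧ z ≠ f x ∧ z ≠ f y) ∧ reglue f x y z = f z) := by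
  unfold reglue
  split_ifs <;> tauto

theorem reglue_left : reglue f x y x = y := if_pos rfl

theorem reglue_right : reglue f x y y = x := by
  by_cases h : y = x
  · rw [reglue, if_pos h, h]
  · rw [reglue, if_neg h, if_pos rfl]

theorem reglue_of_ne {z : X} (h1 : z ≠ x) (h2 : z ≠ y) (h3 : z ≠ f x) (h4 : z ≠ f y) :
    reglue f x y z = f z := by
  rw [reglue, if_neg h1, if_neg h2, if_neg h3, if_neg h4]

theorem HasExits.reglue_f_left (h : HasExits f Y x y) (hfne : ∀ x, f x ≠ x) :
    reglue f x y (f x) = f y := by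
  rw [reglue, if_neg (hfne x), if_neg h.right_ne.symm, if_pos rfl]

theorem HasExits.reglue_f_right (h : HasExits f Y x y) (hf : ∀ x, f (f x) = x)
    (hfne : ∀ x, f x ≠ x) : reglue f x y (f y) = f x := by
  have : f y ≠ f x := fun he => h.ne (by rw [← hf x, ← he, hf])
  simp [reglue, hfne, h.left_ne.symm, this]

theorem HasExits.reglue_reglue (h : HasExits f Y x y) (hf : ∀ x, f (f x) = x)
    (hfne : ∀ x, f x ≠ x) (z : X) : reglue f x y (reglue f x y z) = z := by
  rcases reglue_cases f x y z with ⟨h1, h2⟩ | ⟨h1, h2⟩ | ⟨h1, h2⟩ | ⟨h1, h2⟩ | ⟨h1, h2⟩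
  · rw [h2, reglue_right, h1]
  · rw [h2, reglue_left, h1]
  · rw [h2, h.reglue_f_right hf hfne, h1]
  · rw [h2, h.reglue_f_left hfne, h1]
  · rw [h2, reglue_of_ne, hf]
    · exact fun he => h1.2.2.1 (by rw [← he, hf])
    · exact fun he => h1.2.2.2 (by rw [← he, hf])
    · exact fun he => h1.1 (by rw [← hf z, he, hf])
    · exact fun he => h1.2.1 (by rw [← hf z, he, hf])

theorem HasExits.reglue_ne (h : HasExits f Y x y) (hf : ∀ x, f (f x) = x)
    (hfne : ∀ x, f x ≠ x) (z : X) : reglue f x y z ≠ z := by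
  rcases reglue_cases f x y z with ⟨h1, h2⟩ | ⟨h1, h2⟩ | ⟨h1, h2⟩ | ⟨h1, h2⟩ | ⟨h1, h2⟩ <;>
    rw [h2]
  · rw [h1]; exact h.ne.symm
  · rw [h1]; exact h.ne
  · rw [h1]; exact fun he => h.ne (by rw [← hf x, ← he, hf])
  · rw [h1]; exact fun he => h.ne (by rw [← hf x, he, hf])
  · exact hfne z

theorem HasExits.reglue_mem (h : HasExits f Y x y) {z : X} (hz : z ∈ Y) : reglue f x y z ∈ Y := by
  rcases reglue_cases f x y z with ⟨_, h2⟩ | ⟨_, h2⟩ | ⟨h1, _⟩ | ⟨h1, _⟩ | ⟨h1, h2⟩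
  · rw [h2]; exact h.right_mem
  · rw [h2]; exact h.left_mem
  · exact absurd (h1 ▸ hz) h.left_exit
  · exact absurd (h1 ▸ hz) h.right_exit
  · rw [h2]
    by_contra hc
    rcases h.eq_or_eq z hz hc with h | h
    exacts [h1.1 h, h1.2.1 h]

theorem HasExits.reglue_mem_compl (h : HasExits f Y x y) (hf : ∀ x, f (f x) = x)
    (hfne : ∀ x, f x ≠ x) {z : X} (hz : z ∉ Y) : reglue f x y z ∉ Y := fun hc =>
  hz (by simpa [h.reglue_reglue hf hfne] using h.reglue_mem hc)

/-- Cutting a boundary circle at two corners yields one more circle if the exits of one of the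
two pieces are glued to each other. -/
theorem HasExits.numClasses_reglue [Finite X] (h : HasExits f Y x y) (hf : ∀ x, f (f x) = x)
    (hfne : ∀ x, f x ≠ x) (hg : ∀ x, g (g x) = x) (hgne : ∀ x, g x ≠ x)
    (hY : ∀ z ∈ Y, g z ∈ Y) :
    (orbitSetoid (reglue f x y) g).numClasses = (orbitSetoid f g).numClasses + 1 := by
  set s := orbitSetoid (reglue f x y) g
  set t := orbitSetoid f g
  have hYc : ∀ z ∈ Yᶜ, g z ∈ Yᶜ := fun z hz hc => hz (by simpa [hg] using hY _ hc)
  have hsxy : s x y := by simpa [reglue_left] using orbitSetoid_left (reglue f x y) g x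
  have hsxy' : s (f x) (f y) := by
    simpa [h.reglue_f_left hfne] using orbitSetoid_left (reglue f x y) g (f x)
  have htxy : t x y := h.connected hf hfne hg hgne hY (orbitSetoid_right f g)
    fun z _ _ => orbitSetoid_left f g z
  have htxy' : t (f x) (f y) := (h.compl hf).connected hf hfne hg hgne hYc
    (orbitSetoid_right f g) fun z _ _ => orbitSetoid_left f g z
  have hst : s ≤ t := by
    refine orbitSetoid_le (fun z => ?_) (orbitSetoid_right f g)
    rcases reglue_cases f x y z with ⟨h1, h2⟩ | ⟨h1, h2⟩ | ⟨h1, h2⟩ | ⟨h1, h2⟩ | ⟨h1, h2⟩ <;>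
      rw [h2]
    · rw [h1]; exact htxy
    · rw [h1]; exact t.symm htxy
    · rw [h1]; exact htxy'
    · rw [h1]; exact t.symm htxy'
    · exact orbitSetoid_left f g z
  -- After regluing, `Y` is closed under both maps, so `x` and `f x` fall into different classes.
  have h1 : t.numClasses < s.numClasses := by
    refine Setoid.numClasses_lt hst (orbitSetoid_left f g x) fun hc => h.left_exit ?_
    exact orbitSetoid_mem (h.reglue_reglue hf hfne) hg (fun z => h.reglue_mem) hY hc h.left_mem
  -- Identifying `x` with `f x` undoes the cut: `y` is joined to `f y` through the two new pairs.
  have h2 : s.numClasses ≤ t.numClasses + 1 := by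
    refine Setoid.numClasses_le_add_one (a := x) (b := f x) fun r hr hx => ?_
    refine orbitSetoid_le (fun z => ?_) fun z => hr (orbitSetoid_right _ g z)
    have hy : r y (f y) := r.trans (r.symm (hr hsxy)) (r.trans hx (hr hsxy'))
    rcases reglue_cases f x y z with ⟨h1, h2⟩ | ⟨h1, h2⟩ | ⟨h1, h2⟩ | ⟨h1, h2⟩ | ⟨h1, h2⟩
    · rw [h1]; exact hx
    · rw [h1]; exact hy
    · rw [h1, hf]; exact r.symm hx
    · rw [h1, hf]; exact r.symm hy
    · rw [← h2]; exact hr (orbitSetoid_left _ g z)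
  omega

end Reglue

/-! ### Surgery at two corners and cuts -/

namespace RibbonGraph

variable {G : RibbonGraph.{u}}

theorem invol_reglue {Y : Set G.Flag} {x y : G.Flag} (h : HasExits G.τ₁ Y x y) (z : G.Flag) :
    reglue G.τ₁ x y (reglue G.τ₁ x y z) = z := h.reglue_reglue G.invol₁ G.ne₁ z

/-- Cut a vertex disc (or two of them) at two corners and reglue the pieces. -/
noncomputable def reglueCorners {Y : Set G.Flag} {x y : G.Flag} (h : HasExits G.τ₁ Y x y) :
    RibbonGraph.{u} where
  V := Quotient (orbitSetoid (reglue G.τ₁ x y) G.τ₂)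
  E := G.E
  Flag := G.Flag
  finite_V := inferInstance
  finite_E := inferInstance
  finite_Flag := inferInstance
  τ₀ := G.τ₀
  τ₁ := reglue G.τ₁ x y
  τ₂ := G.τ₂
  invol₀ := G.invol₀
  invol₁ := invol_reglue h
  invol₂ := G.invol₂
  comm := G.comm
  ne₀ := G.ne₀
  ne₁ := h.reglue_ne G.invol₁ G.ne₁
  ne₂ := G.ne₂
  ne₀₂ := G.ne₀₂
  vert := Quotient.mk _
  edge := G.edge
  vert_eq_iff _ _ := Quotient.eq
  edge_eq_iff := G.edge_eq_iff
  edge_surjective := G.edge_surjective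

/-- The reglued graph depends only on the two corners, so the set `X` that witnesses the effect on
the boundary of `B` may differ from the set `Y` that defines the surgery. This is what allows
vertices and boundary components to be counted in the same surgery. -/
theorem numClasses_bdry_reglueCorners {X Y : Set G.Flag} {x y : G.Flag}
    (h : HasExits G.τ₁ Y x y) (h' : HasExits G.τ₁ X x y) {B : Set G.E}
    (hX : ∀ z ∈ X, G.along B z ∈ X) :
    ((reglueCorners h).bdry B).numClasses = (G.bdry B).numClasses + 1 :=
  h'.numClasses_reglue G.invol₁ G.ne₁ (along_along B) (along_ne B) hX

/-- A cut of the spanning ribbon subgraph with edge set `S`: a set of flags which is separated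
from its complement by two corners. -/
structure IsCut (S : Set G.E) (Y : Set G.Flag) : Prop where
  τ₂_mem : ∀ z ∈ Y, G.τ₂ z ∈ Y
  τ₀_mem : ∀ z ∈ Y, G.edge z ∈ S → G.τ₀ z ∈ Y
  ncard : {z ∈ Y | G.τ₁ z ∉ Y}.ncard = 2

namespace IsCut

variable {S : Set G.E} {Y : Set G.Flag}

theorem τ₂_mem_iff (h : IsCut S Y) (z : G.Flag) : z ∈ Y ↔ G.τ₂ z ∈ Y :=
  mem_iff_of_involutive G.invol₂ h.τ₂_mem z

theorem τ₀_mem_iff (h : IsCut S Y) {z : G.Flag} (hz : G.edge z ∈ S) : z ∈ Y ↔ G.τ₀ z ∈ Y :=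
  ⟨fun hY => h.τ₀_mem z hY hz, fun hY => by
    simpa [G.invol₀] using h.τ₀_mem _ hY (by rwa [edge_τ₀])⟩

theorem along_mem (h : IsCut S Y) {B : Set G.E} (hB : B ⊆ S) (z : G.Flag) (hz : z ∈ Y) :
    G.along B z ∈ Y := by
  by_cases hzB : G.edge z ∈ B
  · rw [along_of_mem hzB]; exact h.τ₀_mem z hz (hB hzB)
  · rw [along_of_notMem hzB]; exact h.τ₂_mem z hz

theorem compl (h : IsCut S Y) : IsCut S Yᶜ where
  τ₂_mem z hz hc := hz ((h.τ₂_mem_iff z).2 hc)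
  τ₀_mem z hz hS hc := hz ((h.τ₀_mem_iff hS).2 hc)
  ncard := by
    obtain ⟨x, y, hxy⟩ := HasExits.exists_of_ncard h.ncard
    exact (hxy.compl G.invol₁).ncard

theorem edge_mem_iff (h : IsCut S Y) {z w : G.Flag} (hz : G.edge z ∈ S)
    (hzw : G.edge w = G.edge z) : z ∈ Y ↔ w ∈ Y := by
  rcases edge_eq_cases hzw with rfl | rfl | rfl | rfl
  · rfl
  · exact h.τ₀_mem_iff hz
  · exact h.τ₂_mem_iff z
  · rw [h.τ₂_mem_iff z]; exact h.τ₀_mem_iff (by rwa [edge_τ₂])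

/-- Numbers of boundary components are additive over the two sides of a cut. -/
theorem numClasses_bdry_union (h : IsCut S Y) {B C : Set G.E} (hB : B ⊆ S) (hC : C ⊆ S)
    (hBY : ∀ z, G.edge z ∈ B → z ∈ Y) (hCY : ∀ z, G.edge z ∈ C → z ∉ Y) :
    (G.bdry (B ∪ C)).numClasses + (G.bdry ∅).numClasses =
      (G.bdry B).numClasses + (G.bdry C).numClasses := by
  -- Regluing at the two exits raises each of the four counts by one. In the reglued graph no
  -- boundary walk crosses between `Y` and its complement, so each count splits into two, and each
  -- half depends only on the edges of its own side.
  obtain ⟨x, y, hxy⟩ := HasExits.exists_of_ncard h.ncard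
  let G' := reglueCorners hxy
  have hnum : ∀ D ⊆ S, (G'.bdry D).numClasses = (G.bdry D).numClasses + 1 := fun D hD =>
    numClasses_bdry_reglueCorners hxy hxy (h.along_mem hD)
  have hmem : ∀ D ⊆ S, ∀ a b, G'.bdry D a b → a ∈ Y → b ∈ Y := fun D hD a b hab ha =>
    orbitSetoid_mem (invol_reglue hxy) (along_along D) (fun z => hxy.reglue_mem)
      (h.along_mem hD) hab ha
  have hadd : ∀ D ⊆ S, (G'.bdry D).numClasses =
      (G'.bdry D).numClassesOn Y + (G'.bdry D).numClassesOn Yᶜ := fun D hD =>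
    Setoid.numClasses_eq_add _ (hmem D hD)
  have hcongr : ∀ D D', D ⊆ S → D' ⊆ S → (∀ z ∈ Y, G.edge z ∈ D ↔ G.edge z ∈ D') →
      (G'.bdry D).numClassesOn Y = (G'.bdry D').numClassesOn Y := by
    have key : ∀ D D', D ⊆ S → D' ⊆ S → (∀ z ∈ Y, G.edge z ∈ D ↔ G.edge z ∈ D') →
        ∀ a ∈ Y, ∀ b, G'.bdry D a b → G'.bdry D' a b := fun D D' hD hD' hDD a ha b hab =>
      orbitSetoid_congr_on (invol_reglue hxy) (along_along D) (fun z => hxy.reglue_mem)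
        (h.along_mem hD) (fun _ _ => rfl)
        (fun z hz => along_congr (hDD z hz).symm) ha hab
    exact fun D D' hD hD' hDD => Setoid.numClassesOn_congr fun a ha b _ =>
      ⟨key D D' hD hD' hDD a ha b, key D' D hD' hD (fun z hz => (hDD z hz).symm) a ha b⟩
  have hcongr' : ∀ D D', D ⊆ S → D' ⊆ S → (∀ z ∉ Y, G.edge z ∈ D ↔ G.edge z ∈ D') →
      (G'.bdry D).numClassesOn Yᶜ = (G'.bdry D').numClassesOn Yᶜ := by
    have key : ∀ D D', D ⊆ S → D' ⊆ S → (∀ z ∉ Y, G.edge z ∈ D ↔ G.edge z ∈ D') →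
        ∀ a ∈ Yᶜ, ∀ b, G'.bdry D a b → G'.bdry D' a b := fun D D' hD hD' hDD a ha b hab =>
      orbitSetoid_congr_on (invol_reglue hxy) (along_along D)
        (Z := Yᶜ) (fun z => hxy.reglue_mem_compl G.invol₁ G.ne₁)
        (h.compl.along_mem hD) (fun _ _ => rfl)
        (fun z hz => along_congr (hDD z hz).symm) ha hab
    exact fun D D' hD hD' hDD => Setoid.numClassesOn_congr fun a ha b _ =>
      ⟨key D D' hD hD' hDD a ha b, key D' D hD' hD (fun z hz => (hDD z hz).symm) a ha b⟩
  have hBC : B ∪ C ⊆ S := Set.union_subset hB hC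
  have h0 : (∅ : Set G.E) ⊆ S := Set.empty_subset S
  have e1 := hcongr (B ∪ C) B hBC hB fun z hz =>
    ⟨fun h => h.resolve_right fun hc => hCY z hc hz, Or.inl⟩
  have e2 := hcongr' (B ∪ C) C hBC hC fun z hz =>
    ⟨fun h => h.resolve_left fun hc => hz (hBY z hc), Or.inr⟩
  have e3 := hcongr ∅ C h0 hC fun z hz => ⟨fun h => h.elim, fun hc => absurd hz (hCY z hc)⟩
  have e4 := hcongr' ∅ B h0 hB fun z hz => ⟨fun h => h.elim, fun hc => absurd (hBY z hc) hz⟩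
  have a1 := hadd _ hBC
  have a2 := hadd _ hB
  have a3 := hadd _ hC
  have a4 := hadd _ h0
  rw [hnum _ hBC] at a1
  rw [hnum _ hB] at a2
  rw [hnum _ hC] at a3
  rw [hnum _ h0] at a4
  omega

end IsCut

/-- If two corners are joined around a vertex and, compatibly, around a boundary component, of a
spanning ribbon subgraph all of whose components but one are plane and whose Euler genus is at most
one, then they separate it. -/
theorem exists_isCut_of_hasExits {S : Set G.E}
    (hγ : 2 * (G.comps S).numClasses + S.ncard ≤
      (G.bdry ∅).numClasses + (G.bdry S).numClasses + 1)
    {X C : Set G.Flag} {x y : G.Flag} (hX : HasExits G.τ₁ X x y) (hC : HasExits G.τ₁ C x y)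
    (hXτ : ∀ z ∈ X, G.τ₂ z ∈ X) (hCS : ∀ z ∈ C, G.along S z ∈ C) :
    ∃ Z, HasExits G.τ₁ Z x y ∧ IsCut S Z := by
  let G' := reglueCorners hX
  have hX0 : ∀ z ∈ X, G.along ∅ z ∈ X := by rwa [along_empty]
  have h1 : (G'.bdry ∅).numClasses = (G.bdry ∅).numClasses + 1 :=
    numClasses_bdry_reglueCorners hX hX (B := ∅) hX0
  have h2 : (G'.bdry S).numClasses = (G.bdry S).numClasses + 1 :=
    numClasses_bdry_reglueCorners hX hC hCS
  have h3 := genus_bound (G := G') S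
  have h3' : (G'.bdry ∅).numClasses + (G'.bdry S).numClasses ≤
      2 * (G'.comps S).numClasses + S.ncard := h3
  have hτ : ∀ z, z ≠ x → z ≠ y → z ≠ G.τ₁ x → z ≠ G.τ₁ y → G'.comps S z (G.τ₁ z) :=
    fun z a b c d => by
      have := comps_τ₁ (G := G') S z
      rwa [show G'.τ₁ z = G.τ₁ z from reglue_of_ne a b c d] at this
  have hxy : G'.comps S x y := by
    have := comps_τ₁ (G := G') S x
    rwa [show G'.τ₁ x = y from reglue_left] at this
  have hxy' : G'.comps S (G.τ₁ x) (G.τ₁ y) := by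
    have := comps_τ₁ (G := G') S (G.τ₁ x)
    rwa [show G'.τ₁ (G.τ₁ x) = G.τ₁ y from hX.reglue_f_left G.ne₁] at this
  -- Both boundary counts rose by one. If the number of components had not grown, 2k + |S| - f(∅) -
  -- f(S) would have dropped from at most 1 to a negative number.
  have hnot : ¬ G'.comps S x (G.τ₁ x) := by
    intro hc
    have hle : (G'.comps S).numClasses ≤ (G.comps S).numClasses := by
      refine Setoid.numClasses_anti (X := G.Flag) (s := G.comps S) (t := G'.comps S) ?_
      refine comps_le (fun z => ?_) (comps_τ₂ (G := G') S) fun z hz => comps_τ₀ (G := G') hz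
      have hc' : G'.comps S y (G.τ₁ y) :=
        Setoid.trans' _ (Setoid.symm' _ hxy) (Setoid.trans' _ hc hxy')
      by_cases a : z = x
      · rw [a]; exact hc
      by_cases b : z = y
      · rw [b]; exact hc'
      by_cases c : z = G.τ₁ x
      · rw [c, G.invol₁]; exact Setoid.symm' _ hc
      by_cases d : z = G.τ₁ y
      · rw [d, G.invol₁]; exact Setoid.symm' _ hc'
      exact hτ z a b c d
    omega
  -- The component of `x` after the surgery is the required side of the cut.
  have hex : HasExits G.τ₁ {z | G'.comps S x z} x y := by
    refine ⟨hX.ne, Setoid.refl' (G'.comps S) x, hxy, hnot, fun hc => ?_, fun z hz hz' => ?_⟩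
    · exact hnot (Setoid.trans' _ hc (Setoid.symm' _ hxy'))
    · by_contra! hne
      refine hz' (Setoid.trans' _ hz (hτ z hne.1 hne.2 ?_ ?_))
      · rintro rfl; exact hnot hz
      · rintro rfl; exact hnot (Setoid.trans' _ hz (Setoid.symm' _ hxy'))
  exact ⟨_, hex, fun z hz => Setoid.trans' _ hz (comps_τ₂ (G := G') S z),
    fun z hz hS => Setoid.trans' _ hz (comps_τ₀ (G := G') hS), hex.ncard⟩

end RibbonGraph

/-! ### Pigeonhole and counting of isolated classes -/

namespace Setoid

variable {X : Type u} [Finite X]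

/-- If there are many classes that meet a set, then one of them meets it in few points. -/
theorem exists_ncard_lt (s : Setoid X) (T : Set X) {n : ℕ}
    (h : T.ncard < n * s.numClassesOn T) : ∃ a ∈ T, {b ∈ T | s a b}.ncard < n := by
  classical
  have := Fintype.ofFinite X
  by_contra! hcon
  refine absurd h (not_lt.2 ?_)
  rw [numClassesOn, Set.ncard_eq_toFinset_card' T,
    show Quotient.mk s '' T = (T.toFinset.image (Quotient.mk s) : Finset _) by simp,
    Set.ncard_coe_finset]
  refine Finset.mul_card_image_le_card _ _ fun q hq => ?_
  obtain ⟨a, ha, rfl⟩ := Finset.mem_image.1 hq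
  refine (hcon a (by simpa using ha)).trans (le_of_eq ?_)
  rw [← Set.ncard_coe_finset]
  congr 1
  ext b
  simp only [Finset.coe_filter, Set.mem_toFinset, Set.mem_ofPred_eq, Quotient.eq]
  exact and_congr_right fun _ => ⟨s.symm, s.symm⟩

/-- The classes of `s` that avoid `T` are whole classes of `k`, and `k` has at least one class
besides these, namely that of a point of `T`. -/
theorem numClasses_le_of_isolated {s k : Setoid X} {T : Set X} (hT : T.Nonempty) (hsk : s ≤ k)
    (h : ∀ a b, (∀ t ∈ T, ¬ s a t) → k a b → s a b) :
    s.numClasses + 1 ≤ s.numClassesOn T + k.numClasses := by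
  let N : Set X := {a | ∀ t ∈ T, ¬ s a t}
  have hNs : ∀ a b, s a b → a ∈ N → b ∈ N := fun a b hab ha t ht hbt => ha t ht (s.trans hab hbt)
  have hNk : ∀ a b, k a b → a ∈ N → b ∈ N := fun a b hab ha => hNs a b (h a b ha hab) ha
  have e1 := numClasses_eq_add s hNs
  have e2 := numClasses_eq_add k hNk
  have e3 : s.numClassesOn N = k.numClassesOn N :=
    numClassesOn_congr fun a ha b _ => ⟨fun hab => hsk hab, h a b ha⟩
  have e4 : s.numClassesOn Nᶜ = s.numClassesOn T := by
    unfold numClassesOn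
    congr 1
    ext q
    constructor
    · rintro ⟨a, ha, rfl⟩
      have ha' : ¬ ∀ t ∈ T, ¬ s a t := ha
      push Not at ha'
      obtain ⟨t, ht, hat⟩ := ha'
      exact ⟨t, ht, Quotient.sound (s.symm hat)⟩
    · rintro ⟨t, ht, rfl⟩
      exact ⟨t, fun hN => hN t ht (s.refl t), rfl⟩
  have e5 : 0 < k.numClassesOn Nᶜ := by
    obtain ⟨t, ht⟩ := hT
    exact (Set.ncard_pos (Set.toFinite _)).2 ⟨_, t, fun hN => hN t ht (s.refl t), rfl⟩
  omega

end Setoid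

namespace RibbonGraph

/-! ### The radial ribbon graph -/

section Radial

variable (G : RibbonGraph.{u}) (S : Set G.E)

/-- The rotation of the radial ribbon graph: around the vertices for the flags with second
component `true`, around the boundary components for the flags with second component `false`. -/
noncomputable def radialRotation (p : G.Flag × Bool) : G.Flag × Bool :=
  (if p.2 then G.τ₂ p.1 else G.along S p.1, p.2)

theorem radialRotation_true (z : G.Flag) : G.radialRotation S (z, true) = (G.τ₂ z, true) := rfl

theorem radialRotation_false (z : G.Flag) :
    G.radialRotation S (z, false) = (G.along S z, false) := rfl

theorem radialRotation_invol (p : G.Flag × Bool) :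
    G.radialRotation S (G.radialRotation S p) = p := by
  obtain ⟨z, b⟩ := p
  cases b
  · rw [radialRotation_false, radialRotation_false, along_along]
  · rw [radialRotation_true, radialRotation_true, G.invol₂]

/-- The radial ribbon graph of the spanning ribbon subgraph with edge set `S`: its vertices are
the vertices and the boundary components, its edges are the corners. -/
noncomputable def radial : RibbonGraph.{u} where
  V := Quotient (orbitSetoid (G.radialRotation S) fun p => (G.τ₁ p.1, p.2))
  E := Quotient (orbitSetoid G.τ₁ G.τ₁)
  Flag := G.Flag × Bool
  finite_V := inferInstance
  finite_E := inferInstance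
  finite_Flag := inferInstance
  τ₀ p := (p.1, !p.2)
  τ₁ := G.radialRotation S
  τ₂ p := (G.τ₁ p.1, p.2)
  invol₀ p := by simp
  invol₁ := G.radialRotation_invol S
  invol₂ p := by simp [G.invol₁]
  comm p := rfl
  ne₀ p h := by simpa using congrArg Prod.snd h
  ne₁ p h := by
    obtain ⟨z, b⟩ := p
    cases b
    · exact along_ne S z (congrArg Prod.fst h)
    · exact G.ne₂ z (congrArg Prod.fst h)
  ne₂ p h := G.ne₁ p.1 (congrArg Prod.fst h)
  ne₀₂ p h := G.ne₁ p.1 (congrArg Prod.fst h)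
  vert := Quotient.mk _
  edge p := Quotient.mk _ p.1
  vert_eq_iff _ _ := Quotient.eq
  edge_eq_iff p q := by
    rw [Quotient.eq, orbitSetoid_self_iff G.invol₁]
    obtain ⟨z, b⟩ := p
    obtain ⟨w, c⟩ := q
    cases b <;> cases c <;> simp
  edge_surjective q := by
    induction q using Quotient.inductionOn with | h z => exact ⟨(z, true), rfl⟩

/-- The orbits of `τ₂` and `along S` correspond to the faces of the radial ribbon graph: a
quadrilateral for each edge of `S`, and a bigon for each end of any other edge. Each edge of `S`
merges at most two ends into one orbit. -/
theorem numClasses_ends_le :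
    (orbitSetoid G.τ₂ G.τ₂).numClasses ≤ (orbitSetoid G.τ₂ (G.along S)).numClasses + S.ncard := by
  induction S, S.toFinite using Set.Finite.induction_on with
  | empty => simp [along_empty]
  | @insert e B he _ ih =>
    rw [Set.ncard_insert_of_notMem he]
    suffices h : (orbitSetoid G.τ₂ (G.along B)).numClasses ≤
        (orbitSetoid G.τ₂ (G.along (insert e B))).numClasses + 1 by omega
    obtain ⟨x, rfl⟩ := G.edge_surjective e
    refine Setoid.numClasses_le_add_one (a := x) (b := G.τ₀ x) fun r hr hx => ?_
    have r2 : ∀ y, r y (G.τ₂ y) := fun y => hr (orbitSetoid_left _ _ y)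
    refine orbitSetoid_le r2 fun y => ?_
    by_cases hy : G.edge y = G.edge x
    · rw [along_of_mem (by rw [hy]; exact Set.mem_insert _ _)]
      rcases edge_eq_cases hy with rfl | rfl | rfl | rfl
      · exact hx
      · rw [G.invol₀]; exact r.symm hx
      · rw [G.comm]; exact r.trans (r.symm (r2 _)) (r.trans hx (r2 _))
      · rw [G.invol₀, G.comm]; exact r.trans (r.symm (r2 _)) (r.trans (r.symm hx) (r2 _))
    · rw [along_congr (B := B) (by simp [hy])]
      exact hr (orbitSetoid_right _ _ y)

/-- A bound on the number of boundary components of a spanning ribbon subgraph of the radial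
ribbon graph, since the latter has the same Euler genus. -/
theorem radial_bound (Γ : Set (G.radial S).E) :
    2 * ((G.radial S).comps Γ).numClasses + Γ.ncard ≤
      2 * (G.comps S).numClasses + S.ncard + ((G.radial S).bdry Γ).numClasses := by
  have h1 := genus_bound_mono (G := G.radial S) (Set.subset_univ Γ)
  -- With all radial edges present, a boundary walk changes freely between the two levels, so
  -- forgetting the level maps it to a face.
  have h2 : (orbitSetoid G.τ₂ (G.along S)).numClasses ≤
      ((G.radial S).bdry Set.univ).numClasses := by
    refine Setoid.numClasses_le_of_map (X := G.Flag × Bool) Prod.fst ?_ fun y =>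
      ⟨(y, true), Setoid.refl' _ _⟩
    let t : Setoid (G.Flag × Bool) := (orbitSetoid G.τ₂ (G.along S)).comap Prod.fst
    suffices h : (G.radial S).bdry Set.univ ≤ t from fun a b hab => h hab
    refine bdry_le (G := G.radial S) ?_ ?_
    · rintro ⟨z, _ | _⟩
      exacts [orbitSetoid_right _ _ z, orbitSetoid_left _ _ z]
    · intro p
      rw [along_of_mem (G := G.radial S) (Set.mem_univ _)]
      exact Setoid.refl' (orbitSetoid G.τ₂ (G.along S)) p.1
  have h3 : ((G.radial S).comps Set.univ).numClasses ≤ (G.comps S).numClasses := by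
    let k := (G.radial S).comps Set.univ
    have k0 : ∀ p : G.Flag × Bool, k p (p.1, !p.2) := fun p =>
      comps_τ₀ (G := G.radial S) (Set.mem_univ _)
    have k1 : ∀ p : G.Flag × Bool, k p (G.radialRotation S p) := comps_τ₁ (G := G.radial S) _
    have k2 : ∀ p : G.Flag × Bool, k p (G.τ₁ p.1, p.2) := comps_τ₂ (G := G.radial S) _
    refine Setoid.numClasses_le_of_map (Y := G.Flag × Bool) (fun z => (z, true)) ?_ ?_
    · let t : Setoid G.Flag := k.comap fun z => (z, true)
      suffices h : G.comps S ≤ t from fun a b hab => h hab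
      refine comps_le (fun z => k2 (z, true)) (fun z => k1 (z, true)) fun z hz => ?_
      have := k1 (z, false)
      rw [radialRotation_false, along_of_mem hz] at this
      change k (z, true) (G.τ₀ z, true)
      exact Setoid.trans' _ (k0 (z, true)) (Setoid.trans' _ this (k0 (G.τ₀ z, false)))
    · rintro ⟨z, _ | _⟩
      exacts [⟨z, k0 (z, true)⟩, ⟨z, Setoid.refl' _ _⟩]
  -- Corners and ends both pair up the flags, so there are equally many. They cancel between the
  -- number of radial edges and the lower bound for the number of faces, leaving only |S|.
  have h4 : (Set.univ : Set (G.radial S).E).ncard = (orbitSetoid G.τ₁ G.τ₁).numClasses :=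
    Set.ncard_univ _
  have h5 := two_mul_numClasses_involution G.invol₁ G.ne₁
  have h6 := two_mul_numClasses_involution G.invol₂ G.ne₂
  have h7 := G.numClasses_ends_le S
  omega

end Radial

/-! ### Colourings -/

variable {G : RibbonGraph.{u}}

/-- A colouring of the ends of the edges of `G` which on the ends of the edges in `S` indicates
whether the edge lies in `A`. -/
structure IsColouring (S A : Set G.E) (col : G.Flag → Bool) : Prop where
  τ₂ : ∀ z, col (G.τ₂ z) = col z
  edge : ∀ z, G.edge z ∈ S → (col z = true ↔ G.edge z ∈ A)

/-- The corners at which the colour changes. -/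
def mixed (col : G.Flag → Bool) : Set G.Flag := {z | col (G.τ₁ z) ≠ col z}

theorem mem_mixed {col : G.Flag → Bool} {z : G.Flag} :
    z ∈ mixed col ↔ col (G.τ₁ z) ≠ col z := Iff.rfl

theorem τ₁_mem_mixed {col : G.Flag → Bool} {z : G.Flag} :
    G.τ₁ z ∈ mixed col ↔ z ∈ mixed col := by
  rw [mem_mixed, mem_mixed, G.invol₁]
  exact ne_comm

theorem eq_not_of_mem_mixed {col : G.Flag → Bool} {z : G.Flag} (h : z ∈ mixed col) :
    col (G.τ₁ z) = !col z := by
  rw [mem_mixed] at h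
  cases h1 : col z <;> cases h2 : col (G.τ₁ z) <;> simp_all

theorem eq_of_notMem_mixed {col : G.Flag → Bool} {z : G.Flag} (h : z ∉ mixed col) :
    col (G.τ₁ z) = col z := not_not.1 h

namespace IsColouring

variable {S A : Set G.E} {col : G.Flag → Bool}

theorem along (h : IsColouring S A col) (z : G.Flag) : col (G.along S z) = col z := by
  by_cases hz : G.edge z ∈ S
  · rw [along_of_mem hz, Bool.eq_iff_iff, h.edge z hz, h.edge _ (by rwa [edge_τ₀]), edge_τ₀]
  · rw [along_of_notMem hz, h.τ₂]

theorem along_inter (h : IsColouring S A col) {z : G.Flag} (hz : col z = true) :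
    G.along (S ∩ A) z = G.along S z :=
  along_congr ⟨fun hS => hS.1, fun hS => ⟨hS, (h.edge z hS).1 hz⟩⟩

theorem along_inter' (h : IsColouring S A col) {z : G.Flag} (hz : col z = false) :
    G.along (S ∩ A) z = G.τ₂ z :=
  along_of_notMem fun hS => by simp [(h.edge z hS.1).2 hS.2] at hz

theorem along_sdiff (h : IsColouring S A col) {z : G.Flag} (hz : col z = false) :
    G.along (S \ A) z = G.along S z :=
  along_congr ⟨fun hS => hS.1, fun hS => ⟨hS, fun hA => by simp [(h.edge z hS).2 hA] at hz⟩⟩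

theorem along_sdiff' (h : IsColouring S A col) {z : G.Flag} (hz : col z = true) :
    G.along (S \ A) z = G.τ₂ z :=
  along_of_notMem fun hS => hS.2 ((h.edge z hS.1).1 hz)

end IsColouring

/-- The edges of the radial ribbon graph at which the colour changes. -/
def mixedCorners (S : Set G.E) (col : G.Flag → Bool) : Set (G.radial S).E :=
  Quotient.mk (orbitSetoid G.τ₁ G.τ₁) '' mixed col

theorem mem_mixedCorners {S : Set G.E} {col : G.Flag → Bool} (p : G.Flag × Bool) :
    (G.radial S).edge p ∈ mixedCorners S col ↔ p.1 ∈ mixed col := by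
  constructor
  · rintro ⟨z, hz, h⟩
    rcases (orbitSetoid_self_iff G.invol₁ _ _).1 (Quotient.exact h) with h | h
    · rwa [h]
    · rwa [h, τ₁_mem_mixed]
  · exact fun h => ⟨p.1, h, rfl⟩

theorem ncard_mixed_le {S : Set G.E} {col : G.Flag → Bool} :
    (mixed col).ncard ≤ 2 * (mixedCorners S col).ncard := by
  classical
  have := Fintype.ofFinite G.Flag
  suffices h : (mixed col).ncard ≤
      2 * (Quotient.mk (orbitSetoid G.τ₁ G.τ₁) '' mixed col).ncard from h
  rw [Set.ncard_eq_toFinset_card' (mixed col),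
    show Quotient.mk _ '' mixed col =
      ((mixed col).toFinset.image (Quotient.mk (orbitSetoid G.τ₁ G.τ₁)) : Finset _) by simp,
    Set.ncard_coe_finset]
  refine Finset.card_le_mul_card_image _ _ fun q hq => ?_
  obtain ⟨a, -, rfl⟩ := Finset.mem_image.1 hq
  refine (Finset.card_le_card (t := {a, G.τ₁ a}) fun z hz => ?_).trans Finset.card_le_two
  have hz' := (orbitSetoid_self_iff G.invol₁ _ _).1
    (Setoid.symm' _ (Quotient.exact (Finset.mem_filter.1 hz).2))
  simpa using hz'

open Classical in
/-- Cross the corner, and change between vertex and boundary component if the corner is mixed. -/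
noncomputable def crossCorner (col : G.Flag → Bool) (p : G.Flag × Bool) : G.Flag × Bool :=
  (G.τ₁ p.1, if p.1 ∈ mixed col then !p.2 else p.2)

theorem crossCorner_of_mem {col : G.Flag → Bool} {z : G.Flag} (h : z ∈ mixed col) (b : Bool) :
    crossCorner col (z, b) = (G.τ₁ z, !b) := by simp [crossCorner, h]

theorem crossCorner_of_notMem {col : G.Flag → Bool} {z : G.Flag} (h : z ∉ mixed col) (b : Bool) :
    crossCorner col (z, b) = (G.τ₁ z, b) := by simp [crossCorner, h]

/-- Boundary walks of `S ∩ A` follow `along S` at flags of colour `true` and `τ₂` at the others; for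
`S \ A` it is the other way round. So a flag together with a level determines which of the two walks
is meant: that of `S \ A` if the level equals the colour, that of `S ∩ A` otherwise. At a mixed
corner the colour flips, hence the level must flip too. -/
theorem numClasses_le_crossCorner {S A : Set G.E} {col : G.Flag → Bool}
    (h : IsColouring S A col) :
    (G.bdry (S ∩ A)).numClasses + (G.bdry (S \ A)).numClasses ≤
      (orbitSetoid (G.radialRotation S) (crossCorner col)).numClasses := by
  classical
  unfold Setoid.numClasses
  rw [← Nat.card_sum]
  let φ : G.Flag × Bool → Quotient (G.bdry (S ∩ A)) ⊕ Quotient (G.bdry (S \ A)) := fun p =>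
    if p.2 = col p.1 then Sum.inr (Quotient.mk _ p.1) else Sum.inl (Quotient.mk _ p.1)
  have hle : orbitSetoid (G.radialRotation S) (crossCorner col) ≤ Setoid.ker φ := by
    refine orbitSetoid_le ?_ ?_
    · rintro ⟨z, b⟩
      change φ _ = φ _
      have i1 := bdry_along (S ∩ A) z
      have i2 := bdry_along (S \ A) z
      cases b <;> cases hz : col z
      · rw [h.along_sdiff hz] at i2
        simp only [φ, radialRotation_false, h.along, hz, if_true]
        exact congrArg _ (Quotient.sound i2)
      · rw [h.along_inter hz] at i1
        simp only [φ, radialRotation_false, h.along, hz, Bool.false_eq_true, if_false]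
        exact congrArg _ (Quotient.sound i1)
      · rw [h.along_inter' hz] at i1
        simp only [φ, radialRotation_true, h.τ₂, hz, Bool.true_eq_false, if_false]
        exact congrArg _ (Quotient.sound i1)
      · rw [h.along_sdiff' hz] at i2
        simp only [φ, radialRotation_true, h.τ₂, hz, if_true]
        exact congrArg _ (Quotient.sound i2)
    · rintro ⟨z, b⟩
      change φ _ = φ _
      have key : ∀ c, (c = col (G.τ₁ z) ↔ b = col z) → φ (z, b) = φ (G.τ₁ z, c) := by
        intro c hc
        by_cases hb : b = col z
        · simp only [φ, if_pos hb, if_pos (hc.2 hb)]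
          exact congrArg _ (Quotient.sound (bdry_τ₁ _ z))
        · simp only [φ, if_neg hb, if_neg (mt hc.1 hb)]
          exact congrArg _ (Quotient.sound (bdry_τ₁ _ z))
      by_cases hz : z ∈ mixed col
      · rw [crossCorner_of_mem hz]
        refine key _ ?_
        rw [eq_not_of_mem_mixed hz]
        cases b <;> cases col z <;> simp
      · rw [crossCorner_of_notMem hz]
        refine key _ ?_
        rw [eq_of_notMem_mixed hz]
  refine Nat.card_le_card_of_surjective (Quotient.lift φ fun a b hab => hle hab) ?_
  rintro (q | q)
  · induction q using Quotient.inductionOn with | h z =>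
    exact ⟨Quotient.mk _ (z, !col z), by simp [φ]⟩
  · induction q using Quotient.inductionOn with | h z =>
    exact ⟨Quotient.mk _ (z, col z), by simp [φ]⟩

/-- Among the boundary components of the mixed corners in the radial ribbon graph and the boundary
components of the two colour classes there is one that passes few mixed corners. -/
theorem exists_few_mixed {S A : Set G.E} {col : G.Flag → Bool} (h : IsColouring S A col)
    (hγ : 2 * (G.comps S).numClasses + S.ncard ≤
      (G.bdry (S ∩ A)).numClasses + (G.bdry (S \ A)).numClasses + 1)
    (hm : (mixed col).Nonempty) :
    ∃ κ : G.Flag × Bool → G.Flag × Bool,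
      (κ = crossCorner col ∨ κ = (G.radial S).along (mixedCorners S col)) ∧
      ∃ a ∈ mixed col, {z ∈ mixed col |
        orbitSetoid (G.radialRotation S) κ (a, true) (z, true)}.ncard < 4 := by
  set Γ := mixedCorners S col with hΓ
  let T : Set (G.Flag × Bool) := (fun z => (z, true)) '' mixed col
  have hTinj : Function.Injective fun z : G.Flag => (z, true) := fun _ _ h => congrArg Prod.fst h
  have hT : T.ncard = (mixed col).ncard := Set.ncard_image_of_injective _ hTinj
  let k : Setoid (G.Flag × Bool) := (G.radial S).comps Γ
  -- An orbit without mixed flags is an isolated vertex of the spanning subgraph `Γ` of the radial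
  -- graph, hence a component of it.
  have iso : ∀ κ : G.Flag × Bool → G.Flag × Bool,
      (∀ z ∉ mixed col, ∀ b, κ (z, b) = (G.τ₁ z, b)) →
      (∀ z ∈ mixed col, ∃ w ∈ mixed col, κ (z, false) = (w, true)) →
      (∀ p, k p (κ p)) → (orbitSetoid (G.radialRotation S) κ).numClasses + 1 ≤
        (orbitSetoid (G.radialRotation S) κ).numClassesOn T + k.numClasses := by
    intro κ hκ hκ' hk
    set s := orbitSetoid (G.radialRotation S) κ
    refine Setoid.numClasses_le_of_isolated (hm.image _)
      (orbitSetoid_le (comps_τ₁ (G := G.radial S) Γ) hk) fun a b ha hab => ?_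
    let N : Set (G.Flag × Bool) := {a | ∀ t ∈ T, ¬ s a t}
    have hN : ∀ p ∈ N, p.1 ∉ mixed col := by
      rintro ⟨z, _ | _⟩ hp hz
      · obtain ⟨w, hw, hzw⟩ := hκ' z hz
        have := orbitSetoid_right (G.radialRotation S) κ (z, false)
        rw [hzw] at this
        exact hp _ ⟨w, hw, rfl⟩ this
      · exact hp _ ⟨z, hz, rfl⟩ (Setoid.refl' _ _)
    have hNs : ∀ p q, s p q → p ∈ N → q ∈ N := fun p q hpq hp t ht hqt =>
      hp t ht (Setoid.trans' _ hpq hqt)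
    have r1 : ∀ p, s p (G.radialRotation S p) := orbitSetoid_left _ _
    have r2 : ∀ p ∈ N, s p (G.τ₁ p.1, p.2) := fun p hp => by
      have := orbitSetoid_right (G.radialRotation S) κ p
      rwa [show κ p = (G.τ₁ p.1, p.2) from hκ p.1 (hN p hp) p.2] at this
    have r0 : ∀ p ∈ N, (G.radial S).edge p ∉ Γ := fun p hp =>
      mt (mem_mixedCorners p).1 (hN p hp)
    exact comps_congr_on (G := G.radial S) (B := Γ) (Z := N) (fun p hp => hNs _ _ (r1 p) hp)
      (fun p hp => hNs _ _ (r2 p hp) hp) (fun p hp h => absurd h (r0 p hp))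
      (fun p _ => r1 p) r2 (fun p hp h => absurd h (r0 p hp)) ha hab
  have k0 : ∀ z ∈ mixed col, ∀ b, k (z, b) (z, !b) := fun z hz b =>
    comps_τ₀ (G := G.radial S) ((mem_mixedCorners (z, b)).2 hz)
  have k2 : ∀ p : G.Flag × Bool, k p (G.τ₁ p.1, p.2) := comps_τ₂ (G := G.radial S) _
  have alongΓ : ∀ z ∈ mixed col, ∀ b, (G.radial S).along Γ (z, b) = (z, !b) := fun z hz b =>
    along_of_mem (G := G.radial S) ((mem_mixedCorners (z, b)).2 hz)
  have alongΓ' : ∀ z ∉ mixed col, ∀ b, (G.radial S).along Γ (z, b) = (G.τ₁ z, b) := fun z hz b =>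
    along_of_notMem (G := G.radial S) (mt (mem_mixedCorners (z, b)).1 hz)
  have i1 := iso ((G.radial S).along Γ) alongΓ'
    (fun z hz => ⟨z, hz, alongΓ z hz false⟩) (by
      rintro ⟨z, b⟩
      by_cases hz : z ∈ mixed col
      · rw [alongΓ z hz]; exact k0 z hz b
      · rw [alongΓ' z hz]; exact k2 (z, b))
  have i2 := iso (crossCorner col) (fun z hz => crossCorner_of_notMem hz)
    (fun z hz => ⟨_, τ₁_mem_mixed.2 hz, crossCorner_of_mem hz false⟩) (by
      rintro ⟨z, b⟩
      by_cases hz : z ∈ mixed col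
      · rw [crossCorner_of_mem hz]; exact Setoid.trans' _ (k0 z hz b) (k2 (z, !b))
      · rw [crossCorner_of_notMem hz]; exact k2 (z, b))
  have b1 : 2 * k.numClasses + Γ.ncard ≤ 2 * (G.comps S).numClasses + S.ncard +
      (orbitSetoid (G.radialRotation S) ((G.radial S).along Γ)).numClasses := G.radial_bound S Γ
  have b2 := numClasses_le_crossCorner h
  have b3 : (mixed col).ncard ≤ 2 * Γ.ncard := ncard_mixed_le
  have fin : ∀ κ : G.Flag × Bool → G.Flag × Bool,
      T.ncard < 4 * (orbitSetoid (G.radialRotation S) κ).numClassesOn T →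
      ∃ a ∈ mixed col, {z ∈ mixed col |
        orbitSetoid (G.radialRotation S) κ (a, true) (z, true)}.ncard < 4 := by
    intro κ hκ
    obtain ⟨_, ⟨a, ha, rfl⟩, hlt⟩ := Setoid.exists_ncard_lt _ T hκ
    refine ⟨a, ha, lt_of_le_of_lt ?_ hlt⟩
    rw [← Set.ncard_image_of_injective _ hTinj]
    refine Set.ncard_le_ncard ?_ (Set.toFinite _)
    rintro _ ⟨z, hz, rfl⟩
    exact ⟨⟨z, hz.1, rfl⟩, hz.2⟩
  -- Let t and t' be the numbers of orbits that meet `T` for the two choices of `κ`, and k the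
  -- number of components of `Γ`. By `b1`, `hγ` and `b2`, 2k + |Γ| is at most one more than the
  -- total number of orbits of both kinds, which is at most t + t' + 2k - 2 by `i1` and `i2`. So |Γ|
  -- + 1 ≤ t + t', and with |T| ≤ 2|Γ| this gives 2|T| < 4t + 4t'. Hence |T| < 4t or |T| < 4t'.
  by_cases hlt : T.ncard < 4 * (orbitSetoid (G.radialRotation S) (crossCorner col)).numClassesOn T
  · exact ⟨_, Or.inl rfl, fin _ hlt⟩
  · refine ⟨_, Or.inr rfl, fin _ ?_⟩
    omega

end RibbonGraph

/-! ### Finding a separating pair of corners -/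

namespace RibbonGraph

variable {G : RibbonGraph.{u}} {S A : Set G.E} {col : G.Flag → Bool}

theorem ncard_exits_eq_two {X : Set G.Flag} {B : Set G.E}
    (hX : ∀ z ∈ X, G.along B z ∈ X) (hne : {z ∈ X | G.τ₁ z ∉ X}.Nonempty)
    (hlt : {z ∈ X | G.τ₁ z ∉ X}.ncard < 4) : {z ∈ X | G.τ₁ z ∉ X}.ncard = 2 := by
  have h1 := even_ncard_exits G.invol₁ G.ne₁ (along_along B) (along_ne B) hX
  have h2 := (Set.ncard_pos (Set.toFinite _)).2 hne
  obtain ⟨n, hn⟩ := h1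
  omega

/-- Two corners at which the colour changes, which are joined around a vertex and compatibly
around a boundary component. -/
theorem exists_hasExits_of_mixed (h : IsColouring S A col)
    (hγ : 2 * (G.comps S).numClasses + S.ncard ≤
      (G.bdry (S ∩ A)).numClasses + (G.bdry (S \ A)).numClasses + 1)
    (hm : (mixed col).Nonempty) :
    ∃ (X C : Set G.Flag) (x y : G.Flag), HasExits G.τ₁ X x y ∧ HasExits G.τ₁ C x y ∧
      (∀ z ∈ X, G.τ₂ z ∈ X) ∧ (∀ z ∈ C, G.along S z ∈ C) ∧
      x ∈ mixed col ∧ y ∈ mixed col ∧ col x = col y := by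
  obtain ⟨κ, hκ, a, ha, hlt⟩ := exists_few_mixed h hγ hm
  set s := orbitSetoid (G.radialRotation S) κ with hs
  -- The chosen orbit is split by level: `X` follows vertices, `C` follows boundary components.
  let X : Set G.Flag := {z | s (a, true) (z, true)}
  let C : Set G.Flag := {z | s (a, true) (z, false)}
  have haX : a ∈ X := Setoid.refl' s _
  have sκ : ∀ p, s p (κ p) := orbitSetoid_right _ κ
  have sr : ∀ p, s p (G.radialRotation S p) := orbitSetoid_left _ κ
  have hX2 : ∀ z ∈ X, G.τ₂ z ∈ X := fun z hz => Setoid.trans' s hz (sr (z, true))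
  have hCS : ∀ z ∈ C, G.along S z ∈ C := fun z hz => Setoid.trans' s hz (sr (z, false))
  have hκ0 : ∀ z ∉ mixed col, ∀ b, κ (z, b) = (G.τ₁ z, b) := by
    intro z hz b
    rcases hκ with rfl | rfl
    · exact crossCorner_of_notMem hz b
    · exact along_of_notMem (G := G.radial S) (mt (mem_mixedCorners (z, b)).1 hz)
  have hX0 : ∀ z ∈ X, z ∉ mixed col → G.τ₁ z ∈ X := fun z hz hzm => by
    have := sκ (z, true)
    rw [hκ0 z hzm] at this
    exact Setoid.trans' s hz this
  have hC0 : ∀ z ∈ C, z ∉ mixed col → G.τ₁ z ∈ C := fun z hz hzm => by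
    have := sκ (z, false)
    rw [hκ0 z hzm] at this
    exact Setoid.trans' s hz this
  -- it suffices to identify the exits of the two sets
  have main : ∀ D : Set G.Flag, (∀ z ∈ D, G.along S z ∈ D) → (∀ z ∈ X, col z = col a) →
      {z ∈ D | G.τ₁ z ∉ D} = {z ∈ X | z ∈ mixed col} →
      ∃ (X C : Set G.Flag) (x y : G.Flag), HasExits G.τ₁ X x y ∧ HasExits G.τ₁ C x y ∧
      (∀ z ∈ X, G.τ₂ z ∈ X) ∧ (∀ z ∈ C, G.along S z ∈ C) ∧
      x ∈ mixed col ∧ y ∈ mixed col ∧ col x = col y := by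
    intro D hD hcol hexD
    -- The colour is constant on `X`, so crossing a mixed corner always leaves `X`; crossing any
    -- other corner never does.
    have hexX : {z ∈ X | G.τ₁ z ∉ X} = {z ∈ X | z ∈ mixed col} := by
      ext z
      refine and_congr_right fun hz => ⟨fun hzX => ?_, fun hzm hzX => ?_⟩
      · by_contra hzm
        exact hzX (hX0 z hz hzm)
      · exact hzm ((hcol _ hzX).trans (hcol z hz).symm)
    have h2 : {z ∈ X | G.τ₁ z ∉ X}.ncard = 2 := by
      refine ncard_exits_eq_two (B := ∅) (by rwa [along_empty]) ?_ ?_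
      · rw [hexX]; exact ⟨a, haX, ha⟩
      · rw [hexX]
        convert hlt using 2
        ext z
        exact and_comm
    obtain ⟨x, y, hxy⟩ := HasExits.exists_of_ncard h2
    have hx : x ∈ {z ∈ X | z ∈ mixed col} := hexX ▸ ⟨hxy.left_mem, hxy.left_exit⟩
    have hy : y ∈ {z ∈ X | z ∈ mixed col} := hexX ▸ ⟨hxy.right_mem, hxy.right_exit⟩
    refine ⟨X, D, x, y, hxy, HasExits.of_setOf_eq hxy.ne ?_, hX2, hD, hx.2, hy.2,
      (hcol x hx.1).trans (hcol y hy.1).symm⟩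
    rw [hexD, ← hexX, hxy.setOf_eq]
  rcases hκ with hκ | hκ
  · have hκ1 : ∀ z ∈ mixed col, ∀ b, κ (z, b) = (G.τ₁ z, !b) := fun z hz b => by
      rw [hκ]; exact crossCorner_of_mem hz b
    have hinv : ∀ p, s (a, true) p → (p.2 = true ↔ col p.1 = col a) := by
      let t : Setoid (G.Flag × Bool) := Setoid.ker fun p => decide (p.2 = true ↔ col p.1 = col a)
      have hst : s ≤ t := by
        refine orbitSetoid_le ?_ ?_
        · rintro ⟨z, _ | _⟩
          · exact decide_eq_decide.2 (by rw [radialRotation_false, h.along])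
          · exact decide_eq_decide.2 (by rw [radialRotation_true, h.τ₂])
        · rintro ⟨z, b⟩
          refine decide_eq_decide.2 ?_
          by_cases hz : z ∈ mixed col
          · rw [hκ1 z hz, eq_not_of_mem_mixed hz]
            cases b <;> cases col z <;> cases col a <;> simp
          · rw [hκ0 z hz, eq_of_notMem_mixed hz]
      intro p hp
      exact (decide_eq_decide.1 (hst hp)).1 (by simp)
    have hXc : ∀ z ∈ X, col z = col a := fun z hz => (hinv _ hz).1 rfl
    have hCc : ∀ z ∈ C, col z ≠ col a := fun z hz hc => by simpa using (hinv _ hz).2 hc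
    have hXC : ∀ z ∈ X, z ∈ mixed col → G.τ₁ z ∈ C := fun z hz hzm => by
      have := sκ (z, true)
      rw [hκ1 z hzm] at this
      exact Setoid.trans' s hz this
    have hCX : ∀ z ∈ C, z ∈ mixed col → G.τ₁ z ∈ X := fun z hz hzm => by
      have := sκ (z, false)
      rw [hκ1 z hzm] at this
      exact Setoid.trans' s hz this
    -- Here a mixed corner is crossed while changing level, so the walk leaves `X` exactly where it
    -- enters `C`. The complement of `C` therefore has the same exits as `X`.
    refine main Cᶜ (fun z hz hc => hz ?_) hXc ?_
    · simpa [along_along] using hCS _ hc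
    · ext z
      constructor
      · rintro ⟨hz, hz'⟩
        have hz1 : G.τ₁ z ∈ C := not_not.1 hz'
        have hzm : G.τ₁ z ∈ mixed col := by
          by_contra hzm
          exact hz (by simpa [G.invol₁] using hC0 _ hz1 hzm)
        exact ⟨by simpa [G.invol₁] using hCX _ hz1 hzm, τ₁_mem_mixed.1 hzm⟩
      · rintro ⟨hz, hzm⟩
        exact ⟨fun hc => hCc z hc (hXc z hz), not_not.2 (hXC z hz hzm)⟩
  · have hκ1 : ∀ z ∈ mixed col, ∀ b, κ (z, b) = (z, !b) := fun z hz b => by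
      rw [hκ]; exact along_of_mem (G := G.radial S) ((mem_mixedCorners (z, b)).2 hz)
    have hinv : ∀ p, s (a, true) p → col p.1 = col a := by
      let t : Setoid (G.Flag × Bool) := Setoid.ker fun p => col p.1
      have hst : s ≤ t := by
        refine orbitSetoid_le ?_ ?_
        · rintro ⟨z, _ | _⟩
          · exact (h.along z).symm
          · exact (h.τ₂ z).symm
        · rintro ⟨z, b⟩
          change col z = col (κ (z, b)).1
          by_cases hz : z ∈ mixed col
          · rw [hκ1 z hz]
          · rw [hκ0 z hz, eq_of_notMem_mixed hz]
      exact fun p hp => (hst hp).symm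
    have hXC : ∀ z ∈ mixed col, (z ∈ X ↔ z ∈ C) := fun z hzm => by
      have h1 := sκ (z, true)
      rw [hκ1 z hzm] at h1
      exact ⟨fun hz => Setoid.trans' s hz h1, fun hz => Setoid.trans' s hz (Setoid.symm' s h1)⟩
    -- Here the level changes at the mixed flag itself without crossing the corner, so `X` and `C`
    -- contain the same mixed flags and are left there.
    refine main C hCS (fun z hz => hinv _ hz) ?_
    ext z
    constructor
    · rintro ⟨hz, hz'⟩
      have hzm : z ∈ mixed col := by
        by_contra hzm
        exact hz' (hC0 z hz hzm)
      exact ⟨(hXC z hzm).2 hz, hzm⟩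
    · rintro ⟨hz, hzm⟩
      exact ⟨(hXC z hzm).1 hz, fun hc => hzm ((hinv _ hc).trans (hinv _ hz).symm)⟩

/-- If one side of a cut meets no edges of `S`, then a recolouring decreases the number of
corners at which the colour changes. -/
theorem exists_recolouring (h : IsColouring S A col) {Z : Set G.Flag} {x y : G.Flag}
    (hxy : HasExits G.τ₁ Z x y) (hZ : IsCut S Z) (hZS : ∀ z ∈ Z, G.edge z ∉ S)
    (hx : x ∈ mixed col) (hc : col (G.τ₁ x) = col (G.τ₁ y)) :
    ∃ col', IsColouring S A col' ∧ (mixed col').ncard < (mixed col).ncard := by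
  classical
  -- `Z` receives the colour that is found just outside it at both exits. Then neither exit is
  -- mixed, and no corner becomes mixed.
  let col' : G.Flag → Bool := fun z => if z ∈ Z then col (G.τ₁ x) else col z
  have hin : ∀ z ∈ Z, col' z = col (G.τ₁ x) := fun z hz => if_pos hz
  have hout : ∀ z ∉ Z, col' z = col z := fun z hz => if_neg hz
  have hexit : ∀ z ∈ Z, G.τ₁ z ∉ Z → col' (G.τ₁ z) = col' z := by
    intro z hz hz'
    rw [hin z hz, hout _ hz']
    rcases hxy.eq_or_eq z hz hz' with rfl | rfl
    exacts [rfl, hc.symm]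
  refine ⟨col', ⟨fun z => ?_, fun z hz => ?_⟩, ?_⟩
  · by_cases hz : z ∈ Z
    · rw [hin z hz, hin _ (hZ.τ₂_mem z hz)]
    · rw [hout z hz, hout _ (mt (hZ.τ₂_mem_iff z).2 hz), h.τ₂]
  · rw [hout z fun hzZ => hZS z hzZ hz]
    exact h.edge z hz
  · refine Set.ncard_lt_ncard ⟨fun z hz => ?_, fun hsub => ?_⟩ (Set.toFinite _)
    · by_contra hzm
      refine hz ?_
      by_cases h1 : z ∈ Z <;> by_cases h2 : G.τ₁ z ∈ Z
      · rw [hin z h1, hin _ h2]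
      · exact hexit z h1 h2
      · have := hexit (G.τ₁ z) h2 (by rwa [G.invol₁])
        rw [G.invol₁] at this
        exact this.symm
      · rw [hout z h1, hout _ h2]
        exact eq_of_notMem_mixed hzm
    · exact hsub hx (hexit x hxy.left_mem hxy.left_exit)

/-- If a ribbon graph and its partial dual have Euler genus at most one, and the partial dual is
with respect to a proper subset of the edges, then there is a separating pair of corners. -/
theorem exists_isCut
    (hγ : 2 * (G.comps S).numClasses + S.ncard ≤
      (G.bdry ∅).numClasses + (G.bdry S).numClasses + 1)
    (hγ' : 2 * (G.comps S).numClasses + S.ncard ≤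
      (G.bdry (S ∩ A)).numClasses + (G.bdry (S \ A)).numClasses + 1)
    {a b : G.Flag} (ha : G.edge a ∈ S ∩ A) (hb : G.edge b ∈ S \ A) (hab : G.comps S a b) :
    ∃ Z, IsCut S Z ∧ (∃ z ∈ Z, G.edge z ∈ S) ∧ ∃ z ∉ Z, G.edge z ∈ S := by
  classical
  -- The colouring must vary in the induction on the number of mixed flags, since recolouring ends
  -- of edges outside `S` removes mixed corners.
  have main : ∀ (n : ℕ) (col : G.Flag → Bool), IsColouring S A col → (mixed col).ncard = n →
      ∃ Z, IsCut S Z ∧ (∃ z ∈ Z, G.edge z ∈ S) ∧ ∃ z ∉ Z, G.edge z ∈ S := by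
    intro n
    induction n using Nat.strong_induction_on with
    | _ n ih =>
    intro col h hn
    -- Without mixed corners the colour is constant on components of `S`, but `a` and `b` lie on one
    -- component and have different colours.
    have hm : (mixed col).Nonempty := by
      by_contra hm
      rw [Set.not_nonempty_iff_eq_empty] at hm
      have hcol1 : ∀ z, col (G.τ₁ z) = col z := fun z => eq_of_notMem_mixed (by simp [hm])
      have := comps_mem (Z := {z | col z = true}) (fun z hz => (hcol1 z).trans hz)
        (fun z hz => (h.τ₂ z).trans hz) (fun z hz hzS => by
          have := h.along z
          rw [along_of_mem hzS] at this
          exact this.trans hz) hab ((h.edge a ha.1).2 ha.2)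
      exact hb.2 ((h.edge b hb.1).1 this)
    obtain ⟨X, C, x, y, hX, hC, hX2, hCS, hx, hy, hc⟩ := exists_hasExits_of_mixed h hγ' hm
    obtain ⟨Z, hZ, hcut⟩ := exists_isCut_of_hasExits hγ hX hC hX2 hCS
    by_cases h1 : ∃ z ∈ Z, G.edge z ∈ S
    · by_cases h2 : ∃ z ∉ Z, G.edge z ∈ S
      · exact ⟨Z, hcut, h1, h2⟩
      · push Not at h2
        obtain ⟨col', h', hlt⟩ := exists_recolouring h (hZ.compl G.invol₁) hcut.compl h2
          (τ₁_mem_mixed.2 hx) (by rwa [G.invol₁, G.invol₁])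
        exact ih _ (hn ▸ hlt) col' h' rfl
    · push Not at h1
      obtain ⟨col', h', hlt⟩ := exists_recolouring h hZ hcut h1 hx
        (by rw [eq_not_of_mem_mixed hx, eq_not_of_mem_mixed hy, hc])
      exact ih _ (hn ▸ hlt) col' h' rfl
  refine main _ (fun z => decide (G.edge z ∈ A)) ⟨fun z => ?_, fun z _ => ?_⟩ rfl
  · rw [edge_τ₂]
  · exact decide_eq_true_iff

end RibbonGraph

/-! ### Euler genera of ribbon subgraphs in terms of spanning subgraphs -/

namespace RibbonGraph

variable {G : RibbonGraph.{u}}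

theorem bdry_empty_iff (a b : G.Flag) : G.bdry ∅ a b ↔ G.vert a = G.vert b := by
  rw [G.vert_eq_iff, bdry, along_empty]

theorem numClassesOn_bdry_empty (hG : Function.Surjective G.vert) (U : Set G.V) :
    (G.bdry ∅).numClassesOn {x | G.vert x ∈ U} = U.ncard := by
  let f : Quotient (G.bdry ∅) → G.V := Quotient.lift G.vert fun a b => (bdry_empty_iff a b).1
  have hf : Function.Injective f := by
    intro p q hpq
    induction p using Quotient.inductionOn with | h a =>
    induction q using Quotient.inductionOn with | h b =>
    exact Quotient.sound ((bdry_empty_iff a b).2 hpq)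
  rw [Setoid.numClassesOn, ← Set.ncard_image_of_injective _ hf, Set.image_image]
  congr 1
  ext v
  constructor
  · rintro ⟨x, hx, rfl⟩
    exact hx
  · intro hv
    obtain ⟨x, rfl⟩ := hG v
    exact ⟨x, hv, rfl⟩

theorem numClasses_bdry_empty (hG : Function.Surjective G.vert) :
    (G.bdry ∅).numClasses = Nat.card G.V := by
  have h := numClassesOn_bdry_empty hG Set.univ
  rw [Set.ncard_univ] at h
  rw [← h, Setoid.numClasses, Setoid.numClassesOn,
    show {x : G.Flag | G.vert x ∈ Set.univ} = Set.univ from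
      Set.eq_univ_of_forall fun _ => Set.mem_univ _,
    Set.image_univ, Set.range_eq_univ.2 Quotient.mk_surjective, Set.ncard_univ]

/-- The flags of a vertex form one orbit of `τ₁` and `τ₂`, and `τ₂` preserves `Y`. -/
theorem exists_exit_of_vert_eq {Y : Set G.Flag} {z w : G.Flag} (hY : ∀ z ∈ Y, G.τ₂ z ∈ Y)
    (hz : z ∈ Y) (hw : w ∉ Y) (hzw : G.vert w = G.vert z) :
    ∃ y ∈ Y, G.τ₁ y ∉ Y ∧ G.vert y = G.vert z := by
  by_contra! h
  have := orbitSetoid_mem (Z := {y ∈ Y | G.vert y = G.vert z}) G.invol₁ G.invol₂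
    (fun y hy => ⟨not_not.1 fun hc => h y hy.1 hc hy.2, (vert_τ₁ y).trans hy.2⟩)
    (fun y hy => ⟨hY y hy.1, (vert_τ₂ y).trans hy.2⟩)
    ((G.vert_eq_iff z w).1 hzw.symm) ⟨hz, rfl⟩
  exact hw this.1

/-- The two exits of a cut lie at the same vertex. -/
theorem HasExits.vert_eq {Y : Set G.Flag} {x y : G.Flag} (h : HasExits G.τ₁ Y x y)
    (hY : ∀ z ∈ Y, G.τ₂ z ∈ Y) : G.vert x = G.vert y :=
  (bdry_empty_iff x y).1 <| h.connected G.invol₁ G.ne₁ (along_along ∅) (along_ne ∅)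
    (by rwa [along_empty]) (bdry_along ∅) fun z _ _ => bdry_τ₁ ∅ z

namespace Subgraph

variable {K P Q : G.Subgraph}

theorem vert_τ₀_mem {x : G.Flag} (h : G.edge x ∈ K.edges) : G.vert (G.τ₀ x) ∈ K.verts :=
  K.vert_mem _ (by rwa [edge_τ₀])

theorem Adj.symm {v w : G.V} (h : K.Adj v w) : K.Adj w v := by
  obtain ⟨x, hx, rfl, rfl⟩ := h
  exact ⟨G.τ₀ x, by rwa [edge_τ₀], rfl, by rw [G.invol₀]⟩

theorem reach_symm {v w : G.V} (h : Relation.ReflTransGen K.Adj v w) :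
    Relation.ReflTransGen K.Adj w v := by
  induction h with
  | refl => exact .refl
  | tail _ h ih => exact .head h.symm ih

theorem reach_of_comps {a b : G.Flag} (h : G.comps K.edges a b) :
    Relation.ReflTransGen K.Adj (G.vert a) (G.vert b) := by
  let s : Setoid G.Flag :=
    ⟨fun a b => Relation.ReflTransGen K.Adj (G.vert a) (G.vert b),
      fun _ => .refl, reach_symm, .trans⟩
  have hs : G.comps K.edges ≤ s := by
    refine comps_le (fun x => ?_) (fun x => ?_) fun x hx => .single ⟨x, hx, rfl, rfl⟩
    · change Relation.ReflTransGen K.Adj (G.vert x) (G.vert (G.τ₁ x))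
      rw [vert_τ₁]
    · change Relation.ReflTransGen K.Adj (G.vert x) (G.vert (G.τ₂ x))
      rw [vert_τ₂]
  exact hs h

theorem comps_of_vert_eq (B : Set G.E) {a b : G.Flag} (h : G.vert a = G.vert b) :
    G.comps B a b :=
  comps_mono (Set.empty_subset B) (comps_empty ▸ (bdry_empty_iff a b).2 h)

theorem comps_of_reach {a b : G.Flag}
    (h : Relation.ReflTransGen K.Adj (G.vert a) (G.vert b)) : G.comps K.edges a b := by
  suffices H : ∀ w, Relation.ReflTransGen K.Adj (G.vert a) w → ∀ b, G.vert b = w →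
      G.comps K.edges a b from H _ h b rfl
  intro w hw
  induction hw with
  | refl => exact fun b hb => comps_of_vert_eq _ hb.symm
  | tail _ hadj ih =>
    intro b hb
    obtain ⟨x, hx, hxv, hxw⟩ := hadj
    exact Setoid.trans' _ (ih x hxv)
      (Setoid.trans' _ (comps_τ₀ hx) (comps_of_vert_eq _ (hxw.trans hb.symm)))

theorem Connected.comps (hK : K.Connected) {a b : G.Flag} (ha : G.vert a ∈ K.verts)
    (hb : G.vert b ∈ K.verts) : G.comps K.edges a b :=
  comps_of_reach (hK.2 _ ha _ hb)

theorem Connected.exists_flag (hK : K.Connected) (hE : K.edges.Nonempty) {v : G.V}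
    (hv : v ∈ K.verts) : ∃ x, G.edge x ∈ K.edges ∧ G.vert x = v := by
  obtain ⟨e, he⟩ := hE
  obtain ⟨y, rfl⟩ := G.edge_surjective e
  rcases Relation.ReflTransGen.cases_head (hK.2 v hv _ (K.vert_mem y he)) with h | ⟨w, hvw, -⟩
  · exact ⟨y, he, h.symm⟩
  · obtain ⟨x, hx, hxv, -⟩ := hvw
    exact ⟨x, hx, hxv⟩

/-- The Euler genus of the partial dual of a connected ribbon subgraph `K` with respect to the
edges of `K` in `A`. -/
noncomputable def dualGenus (K : G.Subgraph) (A : Set G.E) : ℤ :=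
  2 + 2 * Nat.card G.V - 2 * K.verts.ncard + K.edges.ncard - (G.bdry (K.edges ∩ A)).numClasses
    - (G.bdry (K.edges \ A)).numClasses

/-- In the spanning subgraph with the edges of `K`, each vertex outside `K` is a disc of its own
with one boundary component. As every vertex carries a flag, flag orbits see all of them. -/
theorem numClasses_bdry_add (hG : Function.Surjective G.vert) (K : G.Subgraph) :
    (G.bdry K.edges).numClasses + K.verts.ncard = K.numBoundary + Nat.card G.V := by
  let Y : Set G.Flag := {x | G.vert x ∈ K.verts}
  have h1 : K.numBoundary = (G.bdry K.edges).numClassesOn Y := by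
    have : {v ∈ K.verts | v ∉ Set.range G.vert} = ∅ := by
      ext v; simpa using fun _ => hG v
    rw [numBoundary, this, Set.ncard_empty]
    rfl
  have hv : ∀ z, G.vert (G.along K.edges z) ∈ K.verts ↔ G.vert z ∈ K.verts := by
    intro z
    by_cases hz : G.edge z ∈ K.edges
    · rw [along_of_mem hz]; exact iff_of_true (vert_τ₀_mem hz) (K.vert_mem z hz)
    · rw [along_of_notMem hz, vert_τ₂]
  have h2 := Setoid.numClasses_eq_add (G.bdry K.edges) (Z := Y) fun a b hab ha =>
    orbitSetoid_mem (Z := Y) G.invol₁ (along_along _)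
      (fun z hz => show G.vert (G.τ₁ z) ∈ K.verts by rwa [vert_τ₁]) (fun z hz => (hv z).2 hz) hab ha
  have h3 : (G.bdry K.edges).numClassesOn Yᶜ = (G.bdry ∅).numClassesOn Yᶜ := by
    have hτ : ∀ z ∈ Yᶜ, G.along ∅ z = G.along K.edges z := fun z hz =>
      along_congr ⟨fun h => h.elim, fun h => hz (K.vert_mem z h)⟩
    have c1 : ∀ z ∈ Yᶜ, G.τ₁ z ∈ Yᶜ := fun z hz hc => hz (show G.vert z ∈ K.verts from vert_τ₁ z ▸ hc)
    have c2 : ∀ z ∈ Yᶜ, G.along K.edges z ∈ Yᶜ := fun z hz hc => hz ((hv z).1 hc)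
    refine Setoid.numClassesOn_congr fun a ha b _ => ⟨fun hab => ?_, fun hab => ?_⟩
    · exact orbitSetoid_congr_on G.invol₁ (along_along _) c1 c2 (fun _ _ => rfl) hτ ha hab
    · exact orbitSetoid_congr_on G.invol₁ (along_along _) c1
        (fun z hz => by rw [hτ z hz]; exact c2 z hz) (fun _ _ => rfl)
        (fun z hz => (hτ z hz).symm) ha hab
  have h4 : (G.bdry ∅).numClassesOn Yᶜ = K.vertsᶜ.ncard := numClassesOn_bdry_empty hG K.vertsᶜ
  have h5 := Set.ncard_add_ncard_compl K.verts
  omega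

theorem eulerGenus_eq (hG : Function.Surjective G.vert) (K : G.Subgraph) :
    K.eulerGenus = 2 + Nat.card G.V - 2 * K.verts.ncard + K.edges.ncard
      - (G.bdry K.edges).numClasses := by
  have := numClasses_bdry_add hG K
  unfold eulerGenus eulerChar
  omega

/-- The components are `K` itself and the vertices outside `K`. -/
theorem Connected.numClasses_comps (hG : Function.Surjective G.vert) (hK : K.Connected) :
    (G.comps K.edges).numClasses + K.verts.ncard = 1 + Nat.card G.V := by
  let Y : Set G.Flag := {x | G.vert x ∈ K.verts}
  have hY1 : ∀ z, z ∈ Y ↔ G.τ₁ z ∈ Y := fun z => by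
    change G.vert z ∈ K.verts ↔ G.vert (G.τ₁ z) ∈ K.verts; rw [vert_τ₁]
  have hY2 : ∀ z, z ∈ Y ↔ G.τ₂ z ∈ Y := fun z => by
    change G.vert z ∈ K.verts ↔ G.vert (G.τ₂ z) ∈ K.verts; rw [vert_τ₂]
  have hY0 : ∀ z, G.edge z ∈ K.edges → z ∈ Y := fun z hz => K.vert_mem z hz
  have h2 := Setoid.numClasses_eq_add (G.comps K.edges) (Z := Y) fun a b hab ha =>
    comps_mem (Z := Y) (fun z => (hY1 z).1) (fun z => (hY2 z).1)
      (fun z _ hz => vert_τ₀_mem hz) hab ha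
  have h1 : (G.comps K.edges).numClassesOn Y = 1 := by
    obtain ⟨v, hv⟩ := hK.1
    obtain ⟨x, rfl⟩ := hG v
    rw [Setoid.numClassesOn, Set.ncard_eq_one]
    refine ⟨Quotient.mk _ x, Set.eq_singleton_iff_unique_mem.2 ⟨⟨x, hv, rfl⟩, ?_⟩⟩
    rintro _ ⟨y, hy, rfl⟩
    exact Quotient.sound (hK.comps hy hv)
  have h3 : (G.comps K.edges).numClassesOn Yᶜ = (G.bdry ∅).numClassesOn Yᶜ := by
    rw [← comps_empty]
    refine Setoid.numClassesOn_congr fun a ha b _ =>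
      ⟨fun hab => ?_, fun hab => comps_mono (Set.empty_subset _) hab⟩
    exact comps_congr_on (Z := Yᶜ) (fun z hz => mt (hY1 z).2 hz) (fun z hz => mt (hY2 z).2 hz)
      (fun z hz hS => absurd (hY0 z hS) hz) (fun z _ => comps_τ₁ _ z) (fun z _ => comps_τ₂ _ z)
      (fun z hz hS => absurd (hY0 z hS) hz) ha hab
  have h4 : (G.bdry ∅).numClassesOn Yᶜ = K.vertsᶜ.ncard := numClassesOn_bdry_empty hG K.vertsᶜ
  have h5 := Set.ncard_add_ncard_compl K.verts
  omega

theorem Connected.eulerGenus_nonneg (hG : Function.Surjective G.vert) (hK : K.Connected) :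
    0 ≤ K.eulerGenus := by
  have h1 := genus_bound (G := G) K.edges
  have h2 := hK.numClasses_comps hG
  have h3 := numClasses_bdry_empty hG
  rw [eulerGenus_eq hG]
  omega

theorem Connected.dualGenus_nonneg (hG : Function.Surjective G.vert) (hK : K.Connected)
    (A : Set G.E) : 0 ≤ K.dualGenus A := by
  have h1 := genus_bound_partialDual (G := G) K.edges A
  have h2 := hK.numClasses_comps hG
  unfold dualGenus
  omega

/-- One of the sets `K.edges ∩ A` and `K.edges \ A` is empty and the other is everything; the
formula is symmetric in the two. -/
theorem eulerGenus_eq_dualGenus (hG : Function.Surjective G.vert) {A : Set G.E}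
    (h : K.edges ⊆ A ∨ Disjoint K.edges A) : K.dualGenus A = K.eulerGenus := by
  have h3 := numClasses_bdry_empty hG
  rw [eulerGenus_eq hG]
  unfold dualGenus
  rcases h with h | h
  · rw [Set.inter_eq_left.2 h, Set.sdiff_eq_empty.2 h]
    omega
  · rw [h.inter_eq, h.sdiff_eq_left]
    omega

/-! ### Joins and cuts -/

theorem IsOneSumAt.ncard_edges {v : G.V} (h : IsOneSumAt K P Q v) :
    K.edges.ncard = P.edges.ncard + Q.edges.ncard := by
  rw [h.edges_union, Set.ncard_union_eq (Set.disjoint_iff_inter_eq_empty.2 h.edges_inter)]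

theorem IsOneSumAt.ncard_verts {v : G.V} (h : IsOneSumAt K P Q v) :
    K.verts.ncard + 1 = P.verts.ncard + Q.verts.ncard := by
  rw [h.verts_union, ← Set.ncard_union_add_ncard_inter, h.verts_inter, Set.ncard_singleton]

/-- The `n` consecutive edge ends that begin with the one at the flag `x`. -/
def arc (x : G.Flag) (n : ℕ) : Set G.Flag :=
  {z | ∃ i < n, z = (G.τ₁ ∘ G.τ₂)^[i] x ∨ z = G.τ₂ ((G.τ₁ ∘ G.τ₂)^[i] x)}

theorem τ₂_mem_arc {x : G.Flag} {n : ℕ} {z : G.Flag} (hz : z ∈ arc x n) : G.τ₂ z ∈ arc x n := by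
  obtain ⟨i, hi, rfl | rfl⟩ := hz
  · exact ⟨i, hi, Or.inr rfl⟩
  · exact ⟨i, hi, Or.inl (G.invol₂ _)⟩

/-- Inside the arc the far flag of one end is `τ₁`-adjacent to the near flag of the next, so only
the two extreme flags can be exits. -/
theorem exit_of_arc {x : G.Flag} {n : ℕ} {z : G.Flag} (hz : z ∈ arc x n) (hz' : G.τ₁ z ∉ arc x n) :
    z = x ∨ (z = G.τ₂ ((G.τ₁ ∘ G.τ₂)^[n - 1] x) ∧ G.τ₁ z = (G.τ₁ ∘ G.τ₂)^[n] x) := by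
  obtain ⟨i, hi, rfl | rfl⟩ := hz
  · rcases i with _ | i
    · exact Or.inl rfl
    · refine absurd ⟨i, by omega, Or.inr ?_⟩ hz'
      rw [Function.iterate_succ_apply', Function.comp_apply, G.invol₁]
  · have hs : G.τ₁ (G.τ₂ ((G.τ₁ ∘ G.τ₂)^[i] x)) = (G.τ₁ ∘ G.τ₂)^[i + 1] x := by
      rw [Function.iterate_succ_apply', Function.comp_apply]
    by_cases hin : i + 1 < n
    · exact absurd ⟨i + 1, hin, Or.inl hs⟩ hz'
    · obtain rfl : n = i + 1 := by omega
      exact Or.inr ⟨rfl, hs⟩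

/-- One side consists of the arc together with all flags at the other vertices of `P`. Its only
exits are those of the arc: at most two, an even number, and at least one because both `P` and `Q`
have ends at the common vertex. -/
theorem IsJoin.exists_isCut (h : IsJoin K P Q) :
    ∃ Y, IsCut K.edges Y ∧ (∀ z, G.edge z ∈ P.edges → z ∈ Y) ∧
      ∀ z, G.edge z ∈ Q.edges → z ∉ Y := by
  obtain ⟨v, hs, x, n, rfl, hP, hQ⟩ := h
  set v := G.vert x with hv
  have hvPQ : v ∈ P.verts ∩ Q.verts := hs.verts_inter ▸ Set.mem_singleton v
  have huniq : ∀ w, w ∈ P.verts → w ∈ Q.verts → w = v := fun w h1 h2 => by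
    have : w ∈ P.verts ∩ Q.verts := ⟨h1, h2⟩
    rwa [hs.verts_inter] at this
  have hQarc : ∀ z ∈ arc x n, G.edge z ∉ Q.edges := by
    rintro z ⟨i, hi, rfl | rfl⟩
    · exact hQ i hi
    · rw [edge_τ₂]; exact hQ i hi
  let Y : Set G.Flag := {z | z ∈ arc x n ∨ (G.vert z ∈ P.verts ∧ G.vert z ≠ v)}
  have hPY : ∀ z, G.edge z ∈ P.edges → z ∈ Y := fun z hz => by
    by_cases hzv : G.vert z = v
    · exact Or.inl (hP z hzv hz)
    · exact Or.inr ⟨P.vert_mem z hz, hzv⟩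
  have hQY : ∀ z, G.edge z ∈ Q.edges → z ∉ Y := by
    rintro z hz (hzY | ⟨h1, h2⟩)
    · exact hQarc z hzY hz
    · exact h2 (huniq _ h1 (Q.vert_mem z hz))
  have hY2 : ∀ z ∈ Y, G.τ₂ z ∈ Y := by
    rintro z (hz | hz)
    · exact Or.inl (τ₂_mem_arc hz)
    · right; rwa [vert_τ₂]
  have hYv : ∀ z ∈ Y, G.τ₁ z ∉ Y → z ∈ arc x n ∧ G.τ₁ z ∉ arc x n := by
    rintro z (hz | hz) hz'
    · exact ⟨hz, fun hc => hz' (Or.inl hc)⟩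
    · exact absurd (Or.inr (by rwa [vert_τ₁])) hz'
  refine ⟨Y, ⟨hY2, fun z hz hzK => ?_, ?_⟩, hPY, hQY⟩
  · rw [hs.edges_union] at hzK
    rcases hzK with hzP | hzQ
    · exact hPY _ (by rwa [edge_τ₀])
    · exact absurd hz (hQY z hzQ)
  · have heven := even_ncard_exits G.invol₁ G.ne₁ G.invol₂ G.ne₂ hY2
    have hle : {z ∈ Y | G.τ₁ z ∉ Y}.ncard ≤ 2 := by
      refine (Set.ncard_le_ncard (t := {x, G.τ₂ ((G.τ₁ ∘ G.τ₂)^[n - 1] x)}) ?_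
        (Set.toFinite _)).trans (Set.ncard_insert_le _ _ |>.trans (by simp))
      rintro z ⟨hz, hz'⟩
      obtain ⟨h1, h2⟩ := hYv z hz hz'
      exact (exit_of_arc h1 h2).imp id And.left
    have hpos : 0 < {z ∈ Y | G.τ₁ z ∉ Y}.ncard := by
      obtain ⟨p, hp, hpv⟩ := hs.connected_left.exists_flag hs.nontrivial_left hvPQ.1
      obtain ⟨q, hq, hqv⟩ := hs.connected_right.exists_flag hs.nontrivial_right hvPQ.2
      obtain ⟨y, hy, hy', -⟩ := exists_exit_of_vert_eq hY2 (hPY p hp) (hQY q hq)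
        (hqv.trans hpv.symm)
      exact (Set.ncard_pos (Set.toFinite _)).2 ⟨y, hy, hy'⟩
    obtain ⟨k, hk⟩ := heven
    omega

/-- Edges add, vertices add up to the common one, and boundary counts are additive over the cut that
belongs to the join. -/
theorem IsJoin.eulerGenus (hG : Function.Surjective G.vert) (h : IsJoin K P Q) :
    K.eulerGenus = P.eulerGenus + Q.eulerGenus := by
  obtain ⟨Y, hY, hP, hQ⟩ := h.exists_isCut
  obtain ⟨v, hs, -⟩ := h
  have h1 := hs.ncard_edges
  have h2 := hs.ncard_verts
  have h3 := hY.numClasses_bdry_union (hs.edges_union ▸ Set.subset_union_left)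
    (hs.edges_union ▸ Set.subset_union_right) hP hQ
  rw [← hs.edges_union, numClasses_bdry_empty hG] at h3
  rw [eulerGenus_eq hG, eulerGenus_eq hG, eulerGenus_eq hG]
  omega

theorem IsJoin.dualGenus (hG : Function.Surjective G.vert) (h : IsJoin K P Q) (A : Set G.E) :
    K.dualGenus A = P.dualGenus A + Q.dualGenus A := by
  obtain ⟨Y, hY, hP, hQ⟩ := h.exists_isCut
  obtain ⟨v, hs, -⟩ := h
  have h1 := hs.ncard_edges
  have h2 := hs.ncard_verts
  have hPK : P.edges ⊆ K.edges := hs.edges_union ▸ Set.subset_union_left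
  have hQK : Q.edges ⊆ K.edges := hs.edges_union ▸ Set.subset_union_right
  have h3 := hY.numClasses_bdry_union (B := P.edges ∩ A) (C := Q.edges ∩ A)
    (Set.inter_subset_left.trans hPK) (Set.inter_subset_left.trans hQK)
    (fun z hz => hP z hz.1) (fun z hz => hQ z hz.1)
  have h4 := hY.numClasses_bdry_union (B := P.edges \ A) (C := Q.edges \ A)
    (Set.sdiff_subset.trans hPK) (Set.sdiff_subset.trans hQK)
    (fun z hz => hP z hz.1) (fun z hz => hQ z hz.1)
  rw [← Set.union_inter_distrib_right, ← hs.edges_union, numClasses_bdry_empty hG] at h3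
  rw [← Set.union_sdiff_distrib, ← hs.edges_union, numClasses_bdry_empty hG] at h4
  unfold Subgraph.dualGenus
  omega

/-- The ribbon subgraph that consists of a set of edges and the vertices they meet. -/
def ofEdges (B : Set G.E) : G.Subgraph where
  verts := G.vert '' {x | G.edge x ∈ B}
  edges := B
  vert_mem x hx := ⟨x, hx, rfl⟩

/-- A path in `K` from a vertex of `P` to `v` uses only edges of `P` until it first reaches `v`,
since edges of `Q` meet `P` nowhere else. -/
theorem Connected.of_union (hK : K.Connected) (hPne : P.verts.Nonempty)
    (hPK : P.verts ⊆ K.verts) {v : G.V} (hv : v ∈ K.verts) (hPQ : P.verts ∩ Q.verts = {v})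
    (hE : K.edges ⊆ P.edges ∪ Q.edges) : P.Connected := by
  have key : ∀ w, Relation.ReflTransGen K.Adj w v → w ∈ P.verts →
      Relation.ReflTransGen P.Adj w v := by
    intro w hw
    induction hw using Relation.ReflTransGen.head_induction_on with
    | refl => exact fun _ => .refl
    | @head w w' hadj _ ih =>
      intro hwP
      by_cases hwv : w = v
      · rw [hwv]
      · obtain ⟨x, hx, rfl, rfl⟩ := hadj
        rcases hE hx with hxP | hxQ
        · exact .head ⟨x, hxP, rfl, rfl⟩ (ih (vert_τ₀_mem hxP))
        · have : G.vert x ∈ P.verts ∩ Q.verts := ⟨hwP, Q.vert_mem x hxQ⟩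
          rw [hPQ] at this
          exact absurd this hwv
  exact ⟨hPne, fun a ha b hb => (key a (hK.2 _ (hPK ha) _ hv) ha).trans
    (reach_symm (key b (hK.2 _ (hPK hb) _ hv) hb))⟩

/-- The edges of `S` on one side of a cut. -/
def sideEdges (S : Set G.E) (Y : Set G.Flag) : Set G.E := {e ∈ S | ∃ z ∈ Y, G.edge z = e}

theorem mem_sideEdges {S : Set G.E} {Y : Set G.Flag} (h : IsCut S Y) {z : G.Flag} :
    G.edge z ∈ sideEdges S Y ↔ G.edge z ∈ S ∧ z ∈ Y :=
  and_congr_right fun hz =>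
    ⟨fun ⟨_, hw, hwz⟩ => (h.edge_mem_iff hz hwz).2 hw, fun hzY => ⟨z, hzY, rfl⟩⟩

/-- The two sides of a cut of a connected ribbon graph form a join. -/
theorem isJoin_of_isCut (hK : K.Connected) {Y : Set G.Flag} (hY : IsCut K.edges Y)
    (h1 : ∃ z ∈ Y, G.edge z ∈ K.edges) (h2 : ∃ z ∉ Y, G.edge z ∈ K.edges) :
    IsJoin K (ofEdges (sideEdges K.edges Y)) (ofEdges (sideEdges K.edges Yᶜ)) := by
  set P : G.Subgraph := ofEdges (sideEdges K.edges Y) with hPdef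
  set Q : G.Subgraph := ofEdges (sideEdges K.edges Yᶜ) with hQdef
  have hP : ∀ z, G.edge z ∈ P.edges ↔ G.edge z ∈ K.edges ∧ z ∈ Y := fun z => mem_sideEdges hY
  have hQ : ∀ z, G.edge z ∈ Q.edges ↔ G.edge z ∈ K.edges ∧ z ∉ Y := fun z =>
    mem_sideEdges hY.compl
  obtain ⟨p, hpY, hpK⟩ := h1
  obtain ⟨q, hqY, hqK⟩ := h2
  have hpP := (hP p).2 ⟨hpK, hpY⟩
  have hqQ := (hQ q).2 ⟨hqK, hqY⟩
  obtain ⟨x, y, hxy⟩ := HasExits.exists_of_ncard hY.ncard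
  have hyv : G.vert y = G.vert x := (HasExits.vert_eq hxy hY.τ₂_mem).symm
  have hPv : ∀ u ∈ P.verts, ∃ z ∈ Y, G.edge z ∈ K.edges ∧ G.vert z = u := by
    rintro u ⟨z, hz, rfl⟩
    exact ⟨z, ((hP z).1 hz).2, ((hP z).1 hz).1, rfl⟩
  have hQv : ∀ u ∈ Q.verts, ∃ z ∉ Y, G.edge z ∈ K.edges ∧ G.vert z = u := by
    rintro u ⟨z, hz, rfl⟩
    exact ⟨z, ((hQ z).1 hz).2, ((hQ z).1 hz).1, rfl⟩
  have hPK : P.verts ⊆ K.verts := fun u hu => by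
    obtain ⟨z, -, hz, rfl⟩ := hPv u hu
    exact K.vert_mem z hz
  have hQK : Q.verts ⊆ K.verts := fun u hu => by
    obtain ⟨z, -, hz, rfl⟩ := hQv u hu
    exact K.vert_mem z hz
  have hsub : ∀ u, u ∈ P.verts → u ∈ Q.verts → u = G.vert x := by
    intro u huP huQ
    obtain ⟨z, hz, -, rfl⟩ := hPv u huP
    obtain ⟨w, hw, -, hwz⟩ := hQv _ huQ
    obtain ⟨t, ht, ht', htz⟩ := exists_exit_of_vert_eq hY.τ₂_mem hz hw hwz
    rcases hxy.eq_or_eq t ht ht' with rfl | rfl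
    exacts [htz.symm, htz.symm.trans hyv]
  -- Otherwise no edge of `K` leaves the vertices of `P`, against connectedness.
  have hmeet : ∃ u, u ∈ P.verts ∧ u ∈ Q.verts := by
    by_contra! hdisj
    have key : ∀ u, Relation.ReflTransGen K.Adj (G.vert p) u → u ∈ P.verts := by
      intro u hu
      induction hu with
      | refl => exact P.vert_mem p hpP
      | tail _ hadj ih =>
        obtain ⟨z, hz, rfl, rfl⟩ := hadj
        by_cases hzY : z ∈ Y
        · exact vert_τ₀_mem ((hP z).2 ⟨hz, hzY⟩)
        · exact absurd (Q.vert_mem z ((hQ z).2 ⟨hz, hzY⟩)) (hdisj _ ih)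
    exact hdisj _ (key _ (hK.2 _ (K.vert_mem p hpK) _ (K.vert_mem q hqK))) (Q.vert_mem q hqQ)
  have hinter : P.verts ∩ Q.verts = {G.vert x} := by
    obtain ⟨u, huP, huQ⟩ := hmeet
    refine Set.eq_singleton_iff_unique_mem.2 ⟨?_, fun w hw => hsub w hw.1 hw.2⟩
    rw [← hsub u huP huQ]
    exact ⟨huP, huQ⟩
  have hxPQ : G.vert x ∈ P.verts ∩ Q.verts := hinter ▸ Set.mem_singleton _
  have hE : K.edges = P.edges ∪ Q.edges := by
    ext e
    obtain ⟨z, rfl⟩ := G.edge_surjective e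
    rw [Set.mem_union, hP, hQ]
    tauto
  refine ⟨G.vert x, ⟨?_, ?_, ⟨_, hpP⟩, ⟨_, hqQ⟩, ?_, hE, hinter, ?_⟩, x, ?_⟩
  · exact hK.of_union ⟨_, hxPQ.1⟩ hPK (hPK hxPQ.1) hinter hE.le
  · exact hK.of_union ⟨_, hxPQ.2⟩ hQK (hPK hxPQ.1) (by rwa [Set.inter_comm])
      (by rw [Set.union_comm]; exact hE.le)
  · refine Set.Subset.antisymm (fun u hu => ?_) (Set.union_subset hPK hQK)
    obtain ⟨z, hz, rfl⟩ := hK.exists_flag ⟨_, hpK⟩ hu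
    rw [hE] at hz
    exact hz.imp (P.vert_mem z) (Q.vert_mem z)
  · ext e
    obtain ⟨z, rfl⟩ := G.edge_surjective e
    rw [Set.mem_inter_iff, hP, hQ]
    simp only [Set.mem_empty_iff_false, iff_false]
    tauto
  · -- walk around the vertex from one exit until the set is left
    let ρ : Equiv.Perm G.Flag :=
      ⟨G.τ₁ ∘ G.τ₂, G.τ₂ ∘ G.τ₁, fun z => by simp [G.invol₁, G.invol₂],
        fun z => by simp [G.invol₁, G.invol₂]⟩
    -- The predecessor of `x` in the rotation is `τ₂ (τ₁ x)`, which is outside `Y` because `x` is an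
    -- exit; it is reached after one step less than the order of the rotation.
    have hex : ∃ i, (G.τ₁ ∘ G.τ₂)^[i] x ∉ Y := by
      refine ⟨orderOf ρ - 1, fun hc => hxy.left_exit ?_⟩
      have hpow : (G.τ₁ ∘ G.τ₂)^[orderOf ρ - 1] x = (ρ ^ (orderOf ρ - 1)) x := by
        rw [← Equiv.Perm.iterate_eq_pow]; rfl
      have hinv : ρ ^ (orderOf ρ - 1) = ρ⁻¹ := by
        rw [eq_inv_iff_mul_eq_one, pow_sub_one_mul (orderOf_pos ρ).ne', pow_orderOf_eq_one]
      rw [hpow, hinv] at hc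
      change G.τ₂ (G.τ₁ x) ∈ Y at hc
      exact (hY.τ₂_mem_iff _).2 hc
    classical
    let n := Nat.find hex
    have hn : (G.τ₁ ∘ G.τ₂)^[n] x ∉ Y := Nat.find_spec hex
    have hlt : ∀ i < n, (G.τ₁ ∘ G.τ₂)^[i] x ∈ Y := fun i hi => not_not.1 (Nat.find_min hex hi)
    have harc : arc x n ⊆ Y := by
      rintro z ⟨i, hi, rfl | rfl⟩
      exacts [hlt i hi, hY.τ₂_mem _ (hlt i hi)]
    have hn0 : 0 < n := Nat.pos_of_ne_zero fun h0 => hn (by rw [h0]; exact hxy.left_mem)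
    have hxarc : x ∈ arc x n := ⟨0, hn0, Or.inl rfl⟩
    -- By parity the arc has a second exit. It is the far end of the arc, whose successor is outside
    -- `Y` by the choice of `n`; so it is an exit of `Y`, hence equal to `y`.
    have hyarc : y ∈ arc x n := by
      obtain ⟨t, ht, ht', htx⟩ := exists_exit_ne G.invol₁ G.ne₁ G.invol₂ G.ne₂
        (fun z hz => τ₂_mem_arc hz) hxarc (fun hc => hxy.left_exit (harc hc))
      rcases exit_of_arc ht ht' with rfl | ⟨-, h'⟩
      · exact absurd rfl htx
      · rcases hxy.eq_or_eq t (harc ht) (h' ▸ hn) with rfl | rfl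
        exacts [absurd rfl htx, ht]
    refine ⟨n, rfl, fun z hzv hz => ?_, fun i hi hc => ((hQ _).1 hc).2 (hlt i hi)⟩
    -- A further end of `P` at this vertex would give an exit of `Y \ arc x n`. It cannot leave `Y`,
    -- as both exits of `Y` lie in the arc, and it cannot enter the arc, as both neighbours of the
    -- arc lie outside `Y`.
    by_contra hzarc
    have hzY := ((hP z).1 hz).2
    obtain ⟨t, ht, ht', -⟩ := exists_exit_of_vert_eq (Y := Y \ arc x n) (z := z) (w := x)
      (fun w hw => ⟨hY.τ₂_mem w hw.1, fun hc => hw.2 (by simpa [G.invol₂] using τ₂_mem_arc hc)⟩)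
      ⟨hzY, hzarc⟩ (fun hc => hc.2 hxarc) hzv.symm
    have htY : G.τ₁ t ∈ Y := by
      by_contra hc
      rcases hxy.eq_or_eq t ht.1 hc with rfl | rfl
      exacts [ht.2 hxarc, ht.2 hyarc]
    have htarc : G.τ₁ t ∈ arc x n := by
      by_contra hc
      exact ht' ⟨htY, hc⟩
    rcases exit_of_arc htarc (by rw [G.invol₁]; exact ht.2) with h' | ⟨-, h'⟩
    · exact hxy.left_exit (by rw [← h', G.invol₁]; exact ht.1)
    · rw [G.invol₁] at h'
      exact hn (h' ▸ ht.1)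

end Subgraph

end RibbonGraph

/-! ### Peeling off monochromatic factors -/

namespace RibbonGraph

variable {G : RibbonGraph.{u}}

namespace Subgraph

variable {K L P Q : G.Subgraph} {A : Set G.E}

/-- All edges of the ribbon subgraph lie in `A`, or none does. -/
def Monochromatic (K : G.Subgraph) (A : Set G.E) : Prop := K.edges ⊆ A ∨ Disjoint K.edges A

theorem Connected.exists_isCut (hG : Function.Surjective G.vert) (hK : K.Connected)
    (h1 : K.eulerGenus ≤ 1) (h2 : K.dualGenus A ≤ 1) (hA : ¬ K.Monochromatic A) :
    ∃ Z, IsCut K.edges Z ∧ (∃ z ∈ Z, G.edge z ∈ K.edges) ∧ ∃ z ∉ Z, G.edge z ∈ K.edges := by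
  have h3 := hK.numClasses_comps hG
  have h4 := numClasses_bdry_empty hG
  rw [eulerGenus_eq hG] at h1
  unfold dualGenus at h2
  obtain ⟨hA1, hA2⟩ := not_or.1 hA
  obtain ⟨b, hbK, hbA⟩ := Set.not_subset.1 hA1
  obtain ⟨a, haK, haA⟩ := Set.not_disjoint_iff.1 hA2
  obtain ⟨b, rfl⟩ := G.edge_surjective b
  obtain ⟨a, rfl⟩ := G.edge_surjective a
  exact RibbonGraph.exists_isCut (A := A) (by omega) (by omega) ⟨haK, haA⟩ ⟨hbK, hbA⟩
    (hK.comps (K.vert_mem a haK) (K.vert_mem b hbK))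

/-- Without exits `Y` would be a union of components, but `z` and `w` lie on the same one. -/
theorem Connected.ncard_exits_pos (hK : K.Connected) {Y : Set G.Flag}
    (h₂ : ∀ z ∈ Y, G.τ₂ z ∈ Y) (h₀ : ∀ z ∈ Y, G.edge z ∈ K.edges → G.τ₀ z ∈ Y)
    {z w : G.Flag} (hz : z ∈ Y) (hzK : G.edge z ∈ K.edges) (hw : w ∉ Y)
    (hwK : G.edge w ∈ K.edges) : 0 < {z ∈ Y | G.τ₁ z ∉ Y}.ncard := by
  rw [Set.ncard_pos (Set.toFinite _)]
  by_contra! hne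
  refine hw (comps_mem (fun y hy => ?_) h₂ h₀
    (hK.comps (K.vert_mem z hzK) (K.vert_mem w hwK)) hz)
  by_contra hc
  have : y ∈ {z ∈ Y | G.τ₁ z ∉ Y} := ⟨hy, hc⟩
  rw [hne] at this
  exact this

/-- A cut of one side of a cut yields a smaller cut. -/
theorem Connected.isCut_inter_or (hK : K.Connected) {Y Z : Set G.Flag} (hY : IsCut K.edges Y)
    (hZ : IsCut (sideEdges K.edges Y) Z) (hYc : ∃ z ∉ Y, G.edge z ∈ K.edges)
    (h1 : ∃ z ∈ Z, G.edge z ∈ sideEdges K.edges Y)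
    (h2 : ∃ z ∉ Z, G.edge z ∈ sideEdges K.edges Y) :
    IsCut K.edges (Y ∩ Z) ∨ IsCut K.edges (Y ∩ Zᶜ) := by
  obtain ⟨w, hwY, hwK⟩ := hYc
  have hτ₂ : ∀ W, IsCut (sideEdges K.edges Y) W → ∀ z ∈ Y ∩ W, G.τ₂ z ∈ Y ∩ W :=
    fun W hW z hz => ⟨hY.τ₂_mem z hz.1, hW.τ₂_mem z hz.2⟩
  have hτ₀ : ∀ W, IsCut (sideEdges K.edges Y) W → ∀ z ∈ Y ∩ W, G.edge z ∈ K.edges →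
      G.τ₀ z ∈ Y ∩ W := fun W hW z hz hzK =>
    ⟨hY.τ₀_mem z hz.1 hzK, hW.τ₀_mem z hz.2 ((mem_sideEdges hY).2 ⟨hzK, hz.1⟩)⟩
  have hpos : ∀ W, IsCut (sideEdges K.edges Y) W →
      (∃ z ∈ W, G.edge z ∈ sideEdges K.edges Y) →
      0 < {z ∈ Y ∩ W | G.τ₁ z ∉ Y ∩ W}.ncard := by
    rintro W hW ⟨z, hzW, hz⟩
    obtain ⟨hzK, hzY⟩ := (mem_sideEdges hY).1 hz
    exact hK.ncard_exits_pos (hτ₂ W hW) (hτ₀ W hW) ⟨hzY, hzW⟩ hzK (fun hc => hwY hc.1) hwK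
  have hle : ∀ W, IsCut (sideEdges K.edges Y) W →
      {z ∈ Y ∩ W | G.τ₁ z ∉ Y ∩ W}.ncard ≤ ({z ∈ Y | G.τ₁ z ∉ Y} ∩ W).ncard + 2 := by
    intro W hW
    rw [← hW.ncard]
    refine (Set.ncard_le_ncard ?_ (Set.toFinite _)).trans (Set.ncard_union_le _ _)
    rintro z ⟨⟨hzY, hzW⟩, hz⟩
    by_cases hzY' : G.τ₁ z ∈ Y
    · exact Or.inr ⟨hzW, fun hc => hz ⟨hzY', hc⟩⟩
    · exact Or.inl ⟨⟨hzY, hzY'⟩, hzW⟩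
  have heven : ∀ W, IsCut (sideEdges K.edges Y) W →
      Even {z ∈ Y ∩ W | G.τ₁ z ∉ Y ∩ W}.ncard := fun W hW =>
    even_ncard_exits G.invol₁ G.ne₁ G.invol₂ G.ne₂ (hτ₂ W hW)
  have hsum := Set.ncard_inter_add_ncard_sdiff_eq_ncard {z ∈ Y | G.τ₁ z ∉ Y} Z (Set.toFinite _)
  rw [hY.ncard, Set.sdiff_eq] at hsum
  have a1 := hpos Z hZ h1
  have a2 := hpos Zᶜ hZ.compl h2
  have b1 := hle Z hZ
  have b2 := hle Zᶜ hZ.compl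
  obtain ⟨c1, hc1⟩ := heven Z hZ
  obtain ⟨c2, hc2⟩ := heven Zᶜ hZ.compl
  -- The two exits of `Y` are shared between `Z` and its complement, and each of these contributes
  -- two exits of its own. So the two intersections have at most six exits together; both numbers
  -- are even and positive, hence one of them is 2.
  by_cases h : {z ∈ Y ∩ Z | G.τ₁ z ∉ Y ∩ Z}.ncard = 2
  · exact Or.inl ⟨hτ₂ Z hZ, hτ₀ Z hZ, h⟩
  · exact Or.inr ⟨hτ₂ _ hZ.compl, hτ₀ _ hZ.compl, by omega⟩

/-- A ribbon graph of small Euler genus, whose partial dual has small Euler genus as well, can be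
written as a join with a monochromatic ribbon subgraph. -/
theorem Connected.exists_isJoin (hG : Function.Surjective G.vert) (hK : K.Connected)
    (h1 : K.eulerGenus ≤ 1) (h2 : K.dualGenus A ≤ 1) (hA : ¬ K.Monochromatic A) :
    ∃ P Q, IsJoin K P Q ∧ Q.Monochromatic A := by
  -- Descent on the number of edges on the side `Y`, which becomes the right factor of the join.
  have main : ∀ (n : ℕ) (Y : Set G.Flag), (sideEdges K.edges Y).ncard = n → IsCut K.edges Y →
      (∃ z ∈ Y, G.edge z ∈ K.edges) → (∃ z ∉ Y, G.edge z ∈ K.edges) →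
      ∃ P Q, IsJoin K P Q ∧ Q.Monochromatic A := by
    intro n
    induction n using Nat.strong_induction_on with
    | _ n ih =>
    intro Y hn hY hin hout
    have hJ := isJoin_of_isCut hK hY.compl hout (by simpa using hin)
    rw [compl_compl] at hJ
    set P : G.Subgraph := ofEdges (sideEdges K.edges Yᶜ)
    set Q : G.Subgraph := ofEdges (sideEdges K.edges Y)
    by_cases hQA : Q.Monochromatic A
    · exact ⟨P, Q, hJ, hQA⟩
    obtain ⟨hPc, hQc⟩ : P.Connected ∧ Q.Connected := by
      obtain ⟨v, hs, -⟩ := hJ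
      exact ⟨hs.connected_left, hs.connected_right⟩
    have g1 := hJ.eulerGenus hG
    have g2 := hJ.dualGenus hG A
    have g3 := hPc.eulerGenus_nonneg hG
    have g4 := hPc.dualGenus_nonneg hG A
    -- Both genera are additive and those of `P` are nonnegative, so the bounds pass to `Q`.
    obtain ⟨Z, hZ, hZ1, hZ2⟩ := hQc.exists_isCut hG (A := A) (by omega) (by omega) hQA
    have smaller : ∀ W, IsCut K.edges (Y ∩ W) → (∃ z ∈ W, G.edge z ∈ sideEdges K.edges Y) →
        (∃ z ∉ W, G.edge z ∈ sideEdges K.edges Y) → ∃ P Q, IsJoin K P Q ∧ Q.Monochromatic A := by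
      rintro W hYW ⟨z, hzW, hz⟩ ⟨w, hwW, hw⟩
      obtain ⟨hzK, hzY⟩ := (mem_sideEdges hY).1 hz
      obtain ⟨t, htY, htK⟩ := hout
      refine ih _ ?_ (Y ∩ W) rfl hYW ⟨z, ⟨hzY, hzW⟩, hzK⟩ ⟨t, fun hc => htY hc.1, htK⟩
      rw [← hn]
      refine Set.ncard_lt_ncard ⟨?_, fun hc => hwW ?_⟩ (Set.toFinite _)
      · rintro e ⟨he, y, hy, hye⟩
        exact ⟨he, y, hy.1, hye⟩
      · exact ((mem_sideEdges hYW).1 (hc hw)).2.2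
    rcases hK.isCut_inter_or hY hZ hout hZ1 hZ2 with h | h
    · exact smaller Z h hZ1 hZ2
    · obtain ⟨z, hz, hzQ⟩ := hZ1
      exact smaller Zᶜ h hZ2 ⟨z, not_not.2 hz, hzQ⟩
  obtain ⟨Y, hY, hin, hout⟩ := hK.exists_isCut hG h1 h2 hA
  exact main _ Y rfl hY hin hout

/-! ### Join sequences -/

theorem isJoinSequence_single (K : G.Subgraph) :
    K.IsJoinSequence (l := 0) fun _ => K :=
  ⟨fun _ => K, rfl, fun i => i.elim0, rfl⟩

theorem IsJoinSequence.snoc {l : ℕ} {H : Fin (l + 1) → G.Subgraph} (h : L.IsJoinSequence H)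
    (hJ : IsJoin K L Q) :
    K.IsJoinSequence (l := l + 1) (Fin.snoc (α := fun _ => G.Subgraph) H Q) := by
  obtain ⟨M, h0, hM, hl⟩ := h
  refine ⟨Fin.snoc (α := fun _ => G.Subgraph) M K, ?_, fun i => ?_, Fin.snoc_last _ _⟩
  · rw [← Fin.castSucc_zero, Fin.snoc_castSucc, Fin.snoc_castSucc, h0]
  · induction i using Fin.lastCases with
    | last => rw [Fin.succ_last, Fin.snoc_last, Fin.snoc_last, Fin.snoc_castSucc, hl]; exact hJ
    | cast j =>
      rw [Fin.succ_castSucc, Fin.snoc_castSucc, Fin.snoc_castSucc, Fin.snoc_castSucc]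
      exact hM j

theorem IsJoinSequence.init {l : ℕ} {H : Fin (l + 1 + 1) → G.Subgraph}
    (h : K.IsJoinSequence H) :
    ∃ L : G.Subgraph, L.IsJoinSequence (fun i : Fin (l + 1) => H i.castSucc) ∧
      IsJoin K L (H (Fin.last _)) := by
  obtain ⟨M, h0, hM, hl⟩ := h
  refine ⟨M (Fin.last l).castSucc, ⟨fun i => M i.castSucc, h0, fun i => ?_, rfl⟩, ?_⟩
  · have := hM i.castSucc
    rwa [Fin.succ_castSucc] at this
  · have := hM (Fin.last l)
    rwa [Fin.succ_last, hl] at this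

theorem IsJoinSequence.eq_of_zero {H : Fin 1 → G.Subgraph} (h : K.IsJoinSequence H) :
    H 0 = K := by
  obtain ⟨M, h0, -, hl⟩ := h
  rw [← h0, ← hl]
  rfl

theorem IsJoinSequence.sum_eulerGenus (hG : Function.Surjective G.vert) {l : ℕ}
    {H : Fin (l + 1) → G.Subgraph} (h : K.IsJoinSequence H) :
    K.eulerGenus = ∑ i, (H i).eulerGenus := by
  induction l generalizing K with
  | zero => rw [Fin.sum_univ_one, h.eq_of_zero]
  | succ l ih =>
    obtain ⟨L, hL, hJ⟩ := h.init
    rw [Fin.sum_univ_castSucc, hJ.eulerGenus hG, ih hL]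

theorem IsJoinSequence.sum_dualGenus (hG : Function.Surjective G.vert) (A : Set G.E) {l : ℕ}
    {H : Fin (l + 1) → G.Subgraph} (h : K.IsJoinSequence H) :
    K.dualGenus A = ∑ i, (H i).dualGenus A := by
  induction l generalizing K with
  | zero => rw [Fin.sum_univ_one, h.eq_of_zero]
  | succ l ih =>
    obtain ⟨L, hL, hJ⟩ := h.init
    rw [Fin.sum_univ_castSucc, hJ.dualGenus hG, ih hL]

theorem IsJoin.mem_edges (h : IsJoin K P Q) {e : G.E} :
    e ∈ K.edges ↔ e ∈ P.edges ∨ e ∈ Q.edges := by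
  obtain ⟨v, hs, -⟩ := h
  rw [hs.edges_union, Set.mem_union]

theorem IsJoin.disjoint (h : IsJoin K P Q) : Disjoint P.edges Q.edges := by
  obtain ⟨v, hs, -⟩ := h
  exact Set.disjoint_iff_inter_eq_empty.2 hs.edges_inter

theorem IsJoinSequence.mem_edges {l : ℕ} {H : Fin (l + 1) → G.Subgraph}
    (h : K.IsJoinSequence H) {e : G.E} : e ∈ K.edges ↔ ∃ i, e ∈ (H i).edges := by
  induction l generalizing K with
  | zero => rw [← h.eq_of_zero, Fin.exists_fin_one]
  | succ l ih =>
    obtain ⟨L, hL, hJ⟩ := h.init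
    rw [hJ.mem_edges, ih hL]
    exact (Fin.exists_fin_succ' (P := fun i => e ∈ (H i).edges)).symm

theorem IsJoinSequence.disjoint {l : ℕ} {H : Fin (l + 1) → G.Subgraph}
    (h : K.IsJoinSequence H) {i j : Fin (l + 1)} (hij : i ≠ j) :
    Disjoint (H i).edges (H j).edges := by
  induction l generalizing K with
  | zero => exact absurd (Fin.ext (by omega)) hij
  | succ l ih =>
    obtain ⟨L, hL, hJ⟩ := h.init
    have hsub : ∀ i : Fin (l + 1), (H i.castSucc).edges ⊆ L.edges := fun i e he =>
      hL.mem_edges.2 ⟨i, he⟩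
    induction i using Fin.lastCases with
    | last =>
      induction j using Fin.lastCases with
      | last => exact absurd rfl hij
      | cast j => exact (hJ.disjoint.mono_left (hsub j)).symm
    | cast i =>
      induction j using Fin.lastCases with
      | last => exact hJ.disjoint.mono_left (hsub i)
      | cast j => exact ih hL (fun he => hij (he ▸ rfl))

/-- Since joins are bracketed from the left, the factor split off must be a single final part; this
is why it has to be monochromatic at once. The left factor inherits the genus bounds and has fewer
edges. -/
theorem Connected.exists_isJoinSequence (hG : Function.Surjective G.vert) (hK : K.Connected)
    (h1 : K.eulerGenus ≤ 1) (h2 : K.dualGenus A ≤ 1) :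
    ∃ (l : ℕ) (H : Fin (l + 1) → G.Subgraph), K.IsJoinSequence H ∧
      ∀ i, (H i).Connected ∧ (H i).Monochromatic A := by
  induction hn : K.edges.ncard using Nat.strong_induction_on generalizing K with
  | _ n ih =>
  by_cases hA : K.Monochromatic A
  · exact ⟨0, _, isJoinSequence_single K, fun _ => ⟨hK, hA⟩⟩
  obtain ⟨P, Q, hJ, hQ⟩ := hK.exists_isJoin hG h1 h2 hA
  obtain ⟨v, hs, -⟩ := id hJ
  have g1 := hJ.eulerGenus hG
  have g2 := hJ.dualGenus hG A
  have g3 := hs.connected_right.eulerGenus_nonneg hG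
  have g4 := hs.connected_right.dualGenus_nonneg hG A
  have g5 := hs.ncard_edges
  have g6 := (Set.ncard_pos (Set.toFinite _)).2 hs.nontrivial_right
  obtain ⟨l, H, hH, hH'⟩ := ih P.edges.ncard (by omega) hs.connected_left (by omega) (by omega) rfl
  refine ⟨l + 1, _, hH.snoc hJ, fun i => ?_⟩
  induction i using Fin.lastCases with
  | last => rw [Fin.snoc_last]; exact ⟨hs.connected_right, hQ⟩
  | cast j => rw [Fin.snoc_castSucc]; exact hH' j

theorem IsJoinSequence.monochromatic {l : ℕ} {H : Fin (l + 1) → G.Subgraph}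
    (h : K.IsJoinSequence H) {I : Set (Fin (l + 1))} (hA : A = ⋃ i ∈ I, (H i).edges)
    (i : Fin (l + 1)) : (H i).Monochromatic A := by
  subst hA
  by_cases hi : i ∈ I
  · exact Or.inl (Set.subset_biUnion_of_mem (u := fun i => (H i).edges) hi)
  · refine Or.inr ?_
    simp only [Set.disjoint_iUnion_right]
    exact fun j hj => h.disjoint fun he => hi (he ▸ hj)

theorem IsJoinSequence.exists_eq_iUnion {l : ℕ} {H : Fin (l + 1) → G.Subgraph}
    (h : K.IsJoinSequence H) (hA : A ⊆ K.edges) (hm : ∀ i, (H i).Monochromatic A) :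
    ∃ I : Set (Fin (l + 1)), A = ⋃ i ∈ I, (H i).edges := by
  refine ⟨{i | (H i).edges ⊆ A}, Set.Subset.antisymm (fun e he => ?_) (Set.iUnion₂_subset ?_)⟩
  · obtain ⟨i, hi⟩ := h.mem_edges.1 (hA he)
    refine Set.mem_biUnion ((hm i).resolve_right fun hd => ?_) hi
    exact Set.disjoint_left.1 hd hi he
  · exact fun i hi => hi

end Subgraph

/-! ### The partial dual -/

open Subgraph

/-- Once there is an edge, connectedness excludes isolated vertices, so the counts of flag orbits
apply. -/
theorem vert_surjective [Nonempty G.Flag] (hG : G.Connected) : Function.Surjective G.vert := by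
  intro v
  obtain ⟨x⟩ := ‹Nonempty G.Flag›
  obtain ⟨y, -, hy⟩ := hG.exists_flag ⟨G.edge x, Set.mem_univ _⟩ (Set.mem_univ v)
  exact ⟨y, hy⟩

theorem partialDual_vert_surjective (hG : Function.Surjective G.vert) (A : Set G.E) :
    Function.Surjective (G.partialDual A).vert := by
  rintro (q | ⟨v, hv⟩)
  · induction q using Quotient.inductionOn with | h x => exact ⟨x, rfl⟩
  · exact absurd (hG v) hv

theorem partialDual_connected (hv : Function.Surjective G.vert) (hG : G.Connected)
    (A : Set G.E) : (G.partialDual A).Connected := by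
  have hsurj := partialDual_vert_surjective hv A
  refine ⟨?_, fun v _ w _ => ?_⟩
  · obtain ⟨v, -⟩ := hG.1
    obtain ⟨x, -⟩ := hv v
    exact ⟨(G.partialDual A).vert x, Set.mem_univ _⟩
  · obtain ⟨x, rfl⟩ := hsurj v
    obtain ⟨y, rfl⟩ := hsurj w
    have hxy : G.comps Set.univ x y := hG.comps (Set.mem_univ _) (Set.mem_univ _)
    exact reach_of_comps (K := (G.partialDual A).whole)
      (comps_le_partialDual (Set.subset_univ A) hxy)

/-- The vertices of the dual are the boundary components of `A`, and its boundary components are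
those of the complement of `A`. -/
theorem eulerGenus_partialDual (hG : Function.Surjective G.vert) (A : Set G.E) :
    (G.partialDual A).whole.eulerGenus = G.whole.dualGenus A := by
  have h1 := numClasses_bdry_empty (partialDual_vert_surjective hG A)
  rw [bdry_partialDual_empty] at h1
  have h2 : ((G.partialDual A).bdry Set.univ).numClasses =
      (G.bdry (Set.univ \ A)).numClasses :=
    congrArg (fun s : Setoid G.Flag => s.numClasses) (bdry_partialDual (Set.subset_univ A))
  have h3 : (G.partialDual A).whole.verts.ncard = Nat.card (G.partialDual A).V :=
    Set.ncard_univ _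
  have h4 : G.whole.verts.ncard = Nat.card G.V := Set.ncard_univ _
  rw [eulerGenus_eq (partialDual_vert_surjective hG A), h3]
  unfold dualGenus
  rw [h4]
  change 2 + (Nat.card (G.partialDual A).V : ℤ) - 2 * (Nat.card (G.partialDual A).V : ℤ) +
      ((Set.univ : Set G.E).ncard : ℤ) - (((G.partialDual A).bdry Set.univ).numClasses : ℤ) =
    2 + 2 * (Nat.card G.V : ℤ) - 2 * (Nat.card G.V : ℤ) + ((Set.univ : Set G.E).ncard : ℤ) -
      ((G.bdry (Set.univ ∩ A)).numClasses : ℤ) - ((G.bdry (Set.univ \ A)).numClasses : ℤ)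
  rw [h2, Set.univ_inter]
  have h5 : ((G.bdry A).numClasses : ℤ) = Nat.card (G.partialDual A).V := by exact_mod_cast h1
  omega

/-! ### A single vertex -/

/-- A connected ribbon graph without flags is one disc, capped off to a sphere. Flag orbits do not
see it, so it needs separate treatment. -/
theorem isPlane_of_isEmpty [IsEmpty G.Flag] [Subsingleton G.V] [Nonempty G.V] : G.IsPlane := by
  obtain ⟨v⟩ := ‹Nonempty G.V›
  have hE : IsEmpty G.E := ⟨fun e => by
    obtain ⟨x, -⟩ := G.edge_surjective e
    exact isEmptyElim x⟩
  have hV : (Set.univ : Set G.V).ncard = 1 := by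
    rw [Set.ncard_univ, Nat.card_eq_one_iff_unique]
    exact ⟨inferInstance, ⟨v⟩⟩
  refine ⟨⟨⟨v, Set.mem_univ v⟩, fun a _ b _ => Subsingleton.elim a b ▸ .refl⟩, ?_⟩
  have h1 : G.whole.numBoundary = 1 := by
    have h2 : {x : G.Flag | G.vert x ∈ G.whole.verts} = ∅ := Set.eq_empty_of_isEmpty _
    have h3 : {v ∈ G.whole.verts | v ∉ Set.range G.vert} = Set.univ :=
      Set.eq_univ_of_forall fun v => ⟨Set.mem_univ v, by rintro ⟨x, -⟩; exact isEmptyElim x⟩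
    rw [numBoundary, h2, h3, Set.image_empty, Set.ncard_empty, hV]
  have h4 : G.whole.edges = ∅ := Set.eq_empty_of_isEmpty _
  have h5 : G.whole.verts.ncard = 1 := hV
  rw [Subgraph.eulerGenus, eulerChar, h1, h4, h5, Set.ncard_empty]
  norm_num

theorem not_isRP2_of_isPlane (h : G.IsPlane) : ¬ G.IsRP2 := fun h' => by
  have h1 := h.2
  rw [h'.2] at h1
  exact absurd h1 (by norm_num)

theorem connected_of_isEmpty [IsEmpty G.Flag] (hG : G.Connected) :
    Subsingleton G.V ∧ Nonempty G.V := by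
  refine ⟨⟨fun a b => ?_⟩, hG.1.to_type⟩
  rcases Relation.ReflTransGen.cases_head (hG.2 a (Set.mem_univ a) b (Set.mem_univ b)) with
    h | ⟨_, ⟨x, -⟩, -⟩
  exacts [h, isEmptyElim x]

theorem isPlane_partialDual_of_isEmpty [IsEmpty G.Flag] (hG : G.Connected) (A : Set G.E) :
    (G.partialDual A).IsPlane := by
  obtain ⟨hs, ⟨v⟩⟩ := connected_of_isEmpty hG
  have : IsEmpty (G.partialDual A).Flag := ‹IsEmpty G.Flag›
  have : Nonempty (G.partialDual A).V :=
    ⟨Sum.inr ⟨v, by rintro ⟨x, -⟩; exact isEmptyElim x⟩⟩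
  have : Subsingleton (G.partialDual A).V := by
    constructor
    rintro (p | p) (q | q)
    · induction p using Quotient.inductionOn with | h x => exact isEmptyElim x
    · induction p using Quotient.inductionOn with | h x => exact isEmptyElim x
    · induction q using Quotient.inductionOn with | h x => exact isEmptyElim x
    · exact congrArg _ (Subtype.ext (Subsingleton.elim _ _))
  exact isPlane_of_isEmpty

theorem isPlaneJoinBiseparation_of_isEmpty [IsEmpty G.Flag] (hG : G.Connected) (A : Set G.E) :
    G.IsPlaneJoinBiseparation A := by
  obtain ⟨hs, hne⟩ := connected_of_isEmpty hG
  refine ⟨0, _, isJoinSequence_single G.whole, ⟨∅, ?_⟩, fun _ => isPlane_of_isEmpty⟩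
  ext e
  obtain ⟨x, -⟩ := G.edge_surjective e
  exact isEmptyElim x

theorem not_isRP2JoinBiseparation_of_isEmpty [IsEmpty G.Flag] (hG : G.Connected) (A : Set G.E) :
    ¬ G.IsRP2JoinBiseparation A := by
  obtain ⟨hs, hne⟩ := connected_of_isEmpty hG
  rintro ⟨_ | l, H, hH, -, j, hj, -⟩
  · rw [show j = 0 from Fin.ext (by omega), hH.eq_of_zero] at hj
    exact not_isRP2_of_isPlane isPlane_of_isEmpty hj
  · obtain ⟨L, -, v, hJ, -⟩ := hH.init
    obtain ⟨e, -⟩ := hJ.nontrivial_left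
    obtain ⟨x, -⟩ := G.edge_surjective e
    exact isEmptyElim x

/-! ### Biseparations -/

theorem exists_unique_eq_one_of_sum {ι : Type*} [Fintype ι] {f : ι → ℤ} (h0 : ∀ i, 0 ≤ f i)
    (h : ∑ i, f i = 1) : ∃ j, f j = 1 ∧ ∀ i, i ≠ j → f i = 0 := by
  classical
  obtain ⟨j, hj⟩ : ∃ j, f j ≠ 0 := by
    by_contra! hc
    simp [hc] at h
  have h1 := Finset.add_sum_erase Finset.univ f (Finset.mem_univ j)
  have h2 : 0 ≤ ∑ i ∈ Finset.univ.erase j, f i := Finset.sum_nonneg fun i _ => h0 i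
  have h3 := h0 j
  refine ⟨j, by omega, fun i hi => ?_⟩
  have h4 : ∑ i ∈ Finset.univ.erase j, f i = 0 := by omega
  exact (Finset.sum_eq_zero_iff_of_nonneg fun i _ => h0 i).1 h4 i
    (Finset.mem_erase.2 ⟨hi, Finset.mem_univ i⟩)

/-- The join sequence of a connected ribbon graph into parts that are contained in `A` or disjoint
from `A`, if the ribbon graph and its partial dual have the same small Euler genus. -/
theorem exists_monochromatic_parts (hv : Function.Surjective G.vert) (hG : G.Connected)
    {A : Set G.E} (h1 : G.whole.eulerGenus ≤ 1) (h2 : (G.partialDual A).whole.eulerGenus ≤ 1) :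
    ∃ (l : ℕ) (H : Fin (l + 1) → G.Subgraph), G.whole.IsJoinSequence H ∧
      (∃ I : Set (Fin (l + 1)), A = ⋃ i ∈ I, (H i).edges) ∧ ∀ i, (H i).Connected := by
  rw [eulerGenus_partialDual hv] at h2
  obtain ⟨l, H, hH, hH'⟩ := Connected.exists_isJoinSequence hv hG h1 h2
  exact ⟨l, H, hH, hH.exists_eq_iUnion (Set.subset_univ A) fun i => (hH' i).2, fun i => (hH' i).1⟩

theorem eulerGenus_partialDual_of_isJoinSequence (hv : Function.Surjective G.vert) {A : Set G.E}
    {l : ℕ} {H : Fin (l + 1) → G.Subgraph} (hH : G.whole.IsJoinSequence H)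
    {I : Set (Fin (l + 1))} (hA : A = ⋃ i ∈ I, (H i).edges) :
    (G.partialDual A).whole.eulerGenus = ∑ i, (H i).eulerGenus := by
  rw [eulerGenus_partialDual hv, hH.sum_dualGenus hv]
  exact Finset.sum_congr rfl fun i _ => eulerGenus_eq_dualGenus hv (hH.monochromatic hA i)

/-- A connected ribbon graph and its partial dual are both plane if and only if the partial dual
is with respect to a plane-join-biseparation. -/
theorem isPlane_and_partialDual_isPlane_iff (hG : G.Connected) (A : Set G.E) :
    (G.IsPlane ∧ (G.partialDual A).IsPlane) ↔ G.IsPlaneJoinBiseparation A := by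
  rcases isEmpty_or_nonempty G.Flag with hF | hF
  · obtain ⟨hs, hne⟩ := connected_of_isEmpty hG
    exact iff_of_true ⟨isPlane_of_isEmpty, isPlane_partialDual_of_isEmpty hG A⟩
      (isPlaneJoinBiseparation_of_isEmpty hG A)
  have hv := vert_surjective hG
  have hG' := partialDual_connected hv hG A
  refine ⟨fun ⟨h, h'⟩ => ?_, ?_⟩
  · have h1 := h.2
    have h2 := h'.2
    obtain ⟨l, H, hH, hI, hc⟩ := exists_monochromatic_parts (A := A) hv hG (by omega) (by omega)
    refine ⟨l, H, hH, hI, fun i => ⟨hc i, ?_⟩⟩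
    -- The genera of the parts are nonnegative with sum zero, so they all vanish.
    rw [hH.sum_eulerGenus hv] at h1
    exact (Finset.sum_eq_zero_iff_of_nonneg fun i _ => (hc i).eulerGenus_nonneg hv).1 h1 i
      (Finset.mem_univ i)
  · rintro ⟨l, H, hH, ⟨I, hI⟩, hp⟩
    have h0 : ∑ i, (H i).eulerGenus = 0 := Finset.sum_eq_zero fun i _ => (hp i).2
    exact ⟨⟨hG, (hH.sum_eulerGenus hv).trans h0⟩,
      ⟨hG', (eulerGenus_partialDual_of_isJoinSequence hv hH hI).trans h0⟩⟩

/-- A connected ribbon graph and its partial dual are both `ℝP²` if and only if the partial dual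
is with respect to an `ℝP²`-join-biseparation. -/
theorem isRP2_and_partialDual_isRP2_iff (hG : G.Connected) (A : Set G.E) :
    (G.IsRP2 ∧ (G.partialDual A).IsRP2) ↔ G.IsRP2JoinBiseparation A := by
  rcases isEmpty_or_nonempty G.Flag with hF | hF
  · obtain ⟨hs, hne⟩ := connected_of_isEmpty hG
    exact iff_of_false (fun h => not_isRP2_of_isPlane isPlane_of_isEmpty h.1)
      (not_isRP2JoinBiseparation_of_isEmpty hG A)
  have hv := vert_surjective hG
  have hG' := partialDual_connected hv hG A
  refine ⟨fun ⟨h, h'⟩ => ?_, ?_⟩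
  · have h1 := h.2
    have h2 := h'.2
    obtain ⟨l, H, hH, hI, hc⟩ := exists_monochromatic_parts (A := A) hv hG (by omega) (by omega)
    rw [hH.sum_eulerGenus hv] at h1
    obtain ⟨j, hj, hj'⟩ := exists_unique_eq_one_of_sum
      (fun i => (hc i).eulerGenus_nonneg hv) h1
    exact ⟨l, H, hH, hI, j, ⟨hc j, hj⟩, fun i hi => ⟨hc i, hj' i hi⟩⟩
  · rintro ⟨l, H, hH, ⟨I, hI⟩, j, hj, hp⟩
    have h0 : ∑ i, (H i).eulerGenus = 1 := by
      rw [Finset.sum_eq_single j (fun i _ hi => (hp i hi).2) (by simp), hj.2]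
    exact ⟨⟨hG, (hH.sum_eulerGenus hv).trans h0⟩,
      ⟨hG', (eulerGenus_partialDual_of_isJoinSequence hv hH hI).trans h0⟩⟩

end RibbonGraph

theorem theorem5p3 (G : RibbonGraph.{u}) (hG : G.Connected) (A : Set G.E) :
    ((G.IsPlane ∧ (G.partialDual A).IsPlane) ↔ G.IsPlaneJoinBiseparation A) ∧
    ((G.IsRP2 ∧ (G.partialDual A).IsRP2) ↔ G.IsRP2JoinBiseparation A) :=
  ⟨RibbonGraph.isPlane_and_partialDual_isPlane_iff hG A,
    RibbonGraph.isRP2_and_partialDual_isRP2_iff hG A⟩
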